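/- **Setting.** Let $\mathsf Z$ be a Borel subset of $\mathbb R^m$, let $P$ be a Feller stochastic kernel on $\mathsf Z$, and let $\{z_t\}_{t\ge 0}$ be a Markov process with kernel $P$. Let $\{\zeta_t\}_{t\ge1}$ and $\{\eta_t\}_{t\ge1}$ be i.i.d. with laws $\nu$ and $\mu$ respectively, with these two sequences and $\{z_t\}$ mutually independent. Let $R,Y\ge 0$ be real-valued measurable functions and set $R_t=R(z_t,\zeta_t)$, $Y_t=Y(z_t,\eta_t)$. Hats denote next-period variables. Write $\mathbb E_z=\mathbb E[\,\cdot\mid z_0=z]$, so that $$\mathbb E_z f(\hat z,\hat R,\hat Y)=\int f\big(\hat z,R(\hat z,\hat\zeta),Y(\hat z,\hat\eta)\big)\,P(z,d\hat z)\,\nu(d\hat\zeta)\,\mu(d\hat\eta).$$ Let $\beta\in[0,1)$, let $u:[0,\infty)\to\{-\infty\}\cup\mathbb R$, and let $u'(0):=\infty$. Put $\mathsf S_0=(0,\infty)\times\mathsf Z$. A *feasible policy* is a Borel function $c:\mathsf S_0\to\mathbb R$ with $0\le c(a,z)\le a$. It generates assets $a_{t+1}=R_{t+1}(a_t-c(a_t,z_t))+Y_{t+1}$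 from $(a_0,z_0)=(a,z)\in\mathsf S_0$ (with $c(0,z):=0$) and has lifetime value $V_c(a,z)=\mathbb E_{a,z}\sum_{t\ge0}\beta^t u(c(a_t,z_t))$. A feasible policy $c^*$ is *optimal* if $V_c\le V_{c^*}$ on $\mathsf S_0$ for every feasible policy $c$. Let $\mathscr C$ be the set of continuous functions $c:\mathsf S_0\to\mathbb R$ that are increasing (in the weak sense) in the first argument and satisfy $0<c(a,z)\le a$ and $\sup_{(a,z)\in\mathsf S_0}|u'(c(a,z))-u'(a)|<\infty$. Let $$\rho(c,d)=\sup_{(a,z)\in\mathsf S_0}|u'(c(a,z))-u'(d(a,z))| .$$ The *Coleman operator* $T$ maps $c\in\mathscr C$ to the function whose value at $(a,z)\in \mathsf S_0$ is the $\xi\in(0,a]$ that solves $$u'(\xi)=\max\Big\{\beta\,\mathbb E_z \hat R\,(u'\circ c)\big(\hat R(a-\xi)+\hat Y,\hat z\big),\;u'(a)\Big\}.$$ **Assumptions.** 1. $u$ is real-valued and twice differentiable on $(0,\infty)$ with $u'>0$, $u''<0$ there, $u'(c)\to\infty$ as $c\to0$, $u'(c)\to0$ as $c\to\infty$; and $u(0)\le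 u(c)$ for all $c>0$. 2. $n\ge1$ is an integer such that $\theta:=\beta^n\sup_{z\in\mathsf Z}\mathbb E_z R_1\cdots R_n<1$. 3. $\sum_{t\ge1}\beta^t\,\mathbb E_zY_t<\infty$ for all $z\in\mathsf Z$. 4. $\sup_z\mathbb E_z\hat R<\infty$, $\sup_z\mathbb E_zu'(\hat Y)<\infty$ and $\sup_z\mathbb E_z\hat R\,u'(\hat Y)<\infty$. 5. The functions $z\mapsto R(z,\zeta)$ and $z\mapsto Y(z,\eta)$ (for all $\zeta$, $\eta$), $z\mapsto\mathbb E_z\hat R$ and $z\mapsto\mathbb E_z\hat R\,u'(\hat Y)$ are continuous. **Theorem.** Under Assumptions 1–5, $(\mathscr C,\rho)$ is a complete metric space, the Coleman operator $T$ is a well-defined map from $\mathscr C$ to $\mathscr C$ (for each $c\in\mathscr C$ and $(a,z)\in\mathsf S_0$ the solution $\xi$ exists and is unique, and $Tc\in\mathscr C$), and $T^n$ is a contraction on $(\mathscr C,\rho)$ with modulus $\theta$: $\rho(T^nc,T^nd)\le\theta\,\rho(c,d)$ for all $c,d\in\mathscr C$. Moreover: 1. $T$ has a unique fixed point $c^*\in\mathscr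 C$. 2. $c^*$ is an optimal policy, and it is the only optimal policy in $\mathscr C$. 3. $\rho(T^{nk}c,c^*)\le\theta^k\rho(c,c^*)$ for all $c\in\mathscr C$ and all integers $k\ge0$. -/

import Mathlib

open MeasureTheory ProbabilityTheory Filter Topology Set
open scoped ENNReal NNReal BoundedContinuousFunction

noncomputable section

/-- The data of an income fluctuation problem with capital income risk: the exogenous state lives in
`Z`, the return innovations in `E` and the income innovations in `H`. -/
structure IncomeFluctuation (Z E H : Type*) [TopologicalSpace Z] [MeasurableSpace Z]
    [MeasurableSpace E] [MeasurableSpace H] where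
  /-- discount factor -/
  β : ℝ≥0
  β_lt_one : β < 1
  /-- utility function on `[0, ∞)`, with values in `{-∞} ∪ ℝ` -/
  u : ℝ≥0 → EReal
  u_ne_top : ∀ x, u x ≠ ⊤
  /-- gross return on wealth -/
  R : Z × E → ℝ≥0
  measurable_R : Measurable R
  /-- labor income -/
  Y : Z × H → ℝ≥0
  measurable_Y : Measurable Y
  /-- transition kernel of the exogenous state -/
  P : Kernel Z Z
  isMarkovKernel_P : IsMarkovKernel P
  feller : ∀ f : Z →ᵇ ℝ, Continuous fun z => ∫ y, f y ∂(P z)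
  /-- law of the return innovations -/
  ν : Measure E
  isProbabilityMeasure_ν : IsProbabilityMeasure ν
  /-- law of the income innovations -/
  μ : Measure H
  isProbabilityMeasure_μ : IsProbabilityMeasure μ

namespace IncomeFluctuation

variable {Z E H : Type*} [TopologicalSpace Z] [MeasurableSpace Z] [MeasurableSpace E]
  [MeasurableSpace H] (M : IncomeFluctuation Z E H)

attribute [instance] isMarkovKernel_P isProbabilityMeasure_ν isProbabilityMeasure_μ

/-- The state space `(0, ∞) × Z` of pairs (assets, exogenous state). -/
abbrev State (Z : Type*) : Type _ := Set.Ioi (0 : ℝ) × Z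

/-! ### Utility -/

/-- The utility function as a real function; only its values on `(0, ∞)` are used. -/
def realUtility (x : ℝ) : ℝ := (M.u x.toNNReal).toReal

/-- Marginal utility `u'`; only its values on `(0, ∞)` are used. -/
def marginal (x : ℝ) : ℝ := deriv M.realUtility x

/-- Marginal utility on `[0, ∞)` with the convention `u'(0) = ∞`. -/
def marginalE (x : ℝ) : ℝ≥0∞ := if 0 < x then ENNReal.ofReal (M.marginal x) else ⊤

/-- The assumption on utility. The clause `zero_le` says that `u` does not jump down
to the right of `0`, so that it is increasing and concave on all of `[0, ∞)`. -/
structure UtilityAssumption : Prop where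
  finite : ∀ x, 0 < x → M.u x ≠ ⊥
  zero_le : ∀ x, M.u 0 ≤ M.u x
  differentiable : ∀ x : ℝ, 0 < x → DifferentiableAt ℝ M.realUtility x
  differentiable_marginal : ∀ x : ℝ, 0 < x → DifferentiableAt ℝ M.marginal x
  marginal_pos : ∀ x : ℝ, 0 < x → 0 < M.marginal x
  deriv_marginal_neg : ∀ x : ℝ, 0 < x → deriv M.marginal x < 0
  marginal_zero : Tendsto M.marginal (𝓝[>] 0) atTop
  marginal_infty : Tendsto M.marginal atTop (𝓝 0)

/-! ### The exogenous process -/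

/-- The law `P(z, ·) ⊗ ν ⊗ μ` of next period's `(ẑ, ζ̂, η̂)` when the current exogenous state
is `z`. -/
def shockKernel : Kernel Z (Z × E × H) := M.P ×ₖ Kernel.const Z (M.ν.prod M.μ)

/-- The conditional law of `(z_{t+1}, ζ_{t+1}, η_{t+1})` given `(z_i, ζ_i, η_i)` for `i ≤ t`. -/
def historyKernel (t : ℕ) : Kernel (Finset.Iic t → Z × E × H) (Z × E × H) :=
  M.shockKernel.comap (fun h => (h ⟨t, Finset.mem_Iic.2 le_rfl⟩).1) (by fun_prop)

instance (t : ℕ) : IsMarkovKernel (M.historyKernel t) := by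
  unfold historyKernel shockKernel
  infer_instance

/-- The law of `(z_t, ζ_t, η_t)_{t ≥ 0}` given `z_0 = z`: `z_t` is Markov with kernel `P`, and
`ζ_t`, `η_t` are i.i.d. with laws `ν`, `μ`, all mutually independent. The innovations at time `0`
are never used. -/
def pathLaw (z : Z) : Measure (ℕ → Z × E × H) :=
  Kernel.trajMeasure (X := fun _ => Z × E × H)
    ((Measure.dirac z).prod (M.ν.prod M.μ)) M.historyKernel

/-- `R_t` as a function of the path. -/
def returnAt (ω : ℕ → Z × E × H) (t : ℕ) : ℝ≥0 := M.R ((ω t).1, (ω t).2.1)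

/-- `Y_t` as a function of the path. -/
def incomeAt (ω : ℕ → Z × E × H) (t : ℕ) : ℝ≥0 := M.Y ((ω t).1, (ω t).2.2)

/-- `θ = βⁿ sup_z E_z R_1 ⋯ R_n`. -/
def theta (n : ℕ) : ℝ≥0∞ :=
  (M.β : ℝ≥0∞) ^ n *
    ⨆ z : Z, ∫⁻ ω, ∏ t ∈ Finset.Icc 1 n, (M.returnAt ω t : ℝ≥0∞) ∂(M.pathLaw z)

/-- `E_z R̂`. -/
def meanReturn (z : Z) : ℝ≥0∞ :=
  ∫⁻ x, (M.R (x.1, x.2.1) : ℝ≥0∞) ∂(M.shockKernel z)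

/-- `E_z u'(Ŷ)`. -/
def meanMarginalIncome (z : Z) : ℝ≥0∞ :=
  ∫⁻ x, M.marginalE (M.Y (x.1, x.2.2)) ∂(M.shockKernel z)

/-- `E_z R̂ u'(Ŷ)`. -/
def meanReturnMarginalIncome (z : Z) : ℝ≥0∞ :=
  ∫⁻ x, (M.R (x.1, x.2.1) : ℝ≥0∞) * M.marginalE (M.Y (x.1, x.2.2)) ∂(M.shockKernel z)

/-- Discounted expected income is finite: `∑_{t ≥ 1} βᵗ E_z Y_t < ∞` for all `z`. -/
def IncomeAssumption : Prop :=
  ∀ z : Z, (∑' t : ℕ,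
    (M.β : ℝ≥0∞) ^ (t + 1) * ∫⁻ ω, (M.incomeAt ω (t + 1) : ℝ≥0∞) ∂(M.pathLaw z)) < ⊤

/-- The uniform moment bounds. -/
structure MomentAssumption : Prop where
  mean_return : (⨆ z, M.meanReturn z) < ⊤
  mean_marginal : (⨆ z, M.meanMarginalIncome z) < ⊤
  mean_return_marginal : (⨆ z, M.meanReturnMarginalIncome z) < ⊤

/-- The continuity conditions. -/
structure ContinuityAssumption : Prop where
  continuous_R : ∀ ζ : E, Continuous fun z => M.R (z, ζ)
  continuous_Y : ∀ η : H, Continuous fun z => M.Y (z, η)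
  continuous_meanReturn : Continuous M.meanReturn
  continuous_meanReturnMarginal : Continuous M.meanReturnMarginalIncome

/-! ### Policies, lifetime value, optimality -/

/-- A policy on `(0, ∞) × Z`, extended by `0` to zero assets. -/
def extend (c : State Z → ℝ) (a : ℝ) (z : Z) : ℝ :=
  if h : 0 < a then c (⟨a, h⟩, z) else 0

/-- A feasible policy: Borel measurable with `0 ≤ c(a, z) ≤ a`. -/
def IsFeasible (c : State Z → ℝ) : Prop :=
  Measurable c ∧ ∀ s, 0 ≤ c s ∧ c s ≤ s.1

/-- The asset path `a_{t+1} = R_{t+1} (a_t - c(a_t, z_t)) + Y_{t+1}`, `a_0 = a`. -/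
def assetPath (c : State Z → ℝ) (a : ℝ) (ω : ℕ → Z × E × H) : ℕ → ℝ
  | 0 => a
  | t + 1 =>
    M.returnAt ω (t + 1) *
        (assetPath c a ω t - extend c (assetPath c a ω t) (ω t).1) +
      M.incomeAt ω (t + 1)

/-- Period utility `u(c(a_t, z_t))` along the asset path. -/
def periodUtility (c : State Z → ℝ) (a : ℝ) (ω : ℕ → Z × E × H) (t : ℕ) : EReal :=
  M.u (extend c (M.assetPath c a ω t) (ω t).1).toNNReal

/-- Lifetime value `V_c(a, z) = E_{a,z} ∑_t βᵗ u(c(a_t, z_t))` in `[-∞, ∞)`, as the expected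
discounted sum of the positive parts minus that of the negative parts. -/
def lifetimeValue (c : State Z → ℝ) (s : State Z) : EReal :=
  ((∫⁻ ω, ∑' t, (M.β : ℝ≥0∞) ^ t * (M.periodUtility c s.1 ω t).toENNReal
      ∂(M.pathLaw s.2) : ℝ≥0∞) : EReal) -
  ((∫⁻ ω, ∑' t, (M.β : ℝ≥0∞) ^ t * (-M.periodUtility c s.1 ω t).toENNReal
      ∂(M.pathLaw s.2) : ℝ≥0∞) : EReal)

/-- An optimal policy: feasible, with the largest lifetime value among all feasible policies, at
every initial condition. -/
def IsOptimal (c : State Z → ℝ) : Prop :=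
  IsFeasible c ∧ ∀ d : State Z → ℝ, IsFeasible d →
    ∀ s, M.lifetimeValue d s ≤ M.lifetimeValue c s

/-! ### Candidate policies and the Coleman operator -/

/-- The space `𝒞` of candidate policies. -/
structure Candidate where
  toFun : State Z → ℝ
  continuous : Continuous toFun
  monotone : ∀ z : Z, Monotone fun a : Set.Ioi (0 : ℝ) => toFun (a, z)
  pos : ∀ s, 0 < toFun s
  le_assets : ∀ s, toFun s ≤ s.1
  bounded : ∃ K : ℝ, ∀ s, |M.marginal (toFun s) - M.marginal s.1| ≤ K

variable {M} in
/-- The distance `ρ(c, d) = sup |u' ∘ c - u' ∘ d|`. -/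
def rho (c d : M.Candidate) : ℝ≥0∞ :=
  ⨆ s : State Z, ENNReal.ofReal |M.marginal (c.toFun s) - M.marginal (d.toFun s)|

/-- `ψ_c(ξ, a, z) = max {β E_z R̂ (u' ∘ c)(R̂ (a - ξ) + Ŷ, ẑ), u'(a)}`. -/
def psi (c : State Z → ℝ) (ξ a : ℝ) (z : Z) : ℝ≥0∞ :=
  max
    ((M.β : ℝ≥0∞) * ∫⁻ x, (M.R (x.1, x.2.1) : ℝ≥0∞) *
      M.marginalE (extend c (M.R (x.1, x.2.1) * (a - ξ) + M.Y (x.1, x.2.2)) x.1)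
        ∂(M.shockKernel z))
    (M.marginalE a)

/-- `T` is the Coleman operator: `Tc(a, z)` is the one and only `ξ ∈ (0, a]` that solves
`u'(ξ) = ψ_c(ξ, a, z)`. -/
def IsColeman (T : M.Candidate → M.Candidate) : Prop :=
  ∀ (c : M.Candidate) (s : State Z) (ξ : ℝ),
    (ξ ∈ Set.Ioc (0 : ℝ) s.1 ∧ M.marginalE ξ = M.psi c.toFun ξ s.1 s.2) ↔ ξ = (T c).toFun s

end IncomeFluctuation

end

/-! Everything is measured in marginal utility. The map `c ↦ u' ∘ c - u'` embeds `(𝒞, ρ)`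
isometrically into the bounded continuous functions. Its image is cut out by two closed conditions,
so `𝒞` is complete (`Candidate.range_excess`).

`T` is well defined because `u'` falls strictly from `∞` at `0`, while `ψ_c(ξ, a, z)` is finite,
increasing in `ξ` and at least `u'(a)`: the two graphs cross exactly once in `(0, a]`. The crossing
moves continuously if `ψ` is continuous. The delicate point is that the kernel is only Feller and
the integrand is unbounded; `continuous_eulerMean` settles it by a Fatou argument applied both to
the integrand and to its gap from a dominating function whose mean is continuous by assumption.

Contraction comes from the linear operator `L γ (z) = E_z R̂ γ(ẑ)`. If `u' ∘ c ≤ u' ∘ d + γ(z)`,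
then `u' ∘ Tc ≤ u' ∘ Td + β L γ` (`marginalE_coleman_le`). After `n` steps a constant gap is
multiplied by `βⁿ Lⁿ 1 = βⁿ E_z R_1 ⋯ R_n ≤ θ`, and Banach's theorem applies to `Tⁿ`.

A fixed point satisfies the Euler equation, and optimality is a supporting-price argument. At the
prices `βᵗ u'(c*_t)` the Euler inequality says that saving never pays more than it costs, with
equality whenever `c*` saves, and the priced assets of `c*` tend to `0`. Hence no feasible plan is
worth more than `c*` (`tsum_priced_consumption_le`). Concavity, `u(d_t) - u(c*_t) ≤ u'(c*_t) (d_t -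
c*_t)`, turns this into `V_d ≤ V_{c*}`, and strictness of the tangent inequality at date `0` gives
uniqueness. The summability needed comes again from `θ < 1`, through the operator `L`. Inequalities
are kept in additive form in `[0, ∞]`, so finiteness is needed only when terms are cancelled or
values subtracted. -/

noncomputable section

/-! ### Semicontinuity of kernel integrals -/

/-- The largest `k`-Lipschitz function below `min F k`. -/
def lipschitzReg {X : Type*} [PseudoEMetricSpace X] (F : X → ℝ≥0∞) (k : ℕ) (p : X) : ℝ≥0∞ :=
  ⨅ q, (min (F q) k + k * edist p q)

section LipschitzReg

variable {X : Type*} [PseudoEMetricSpace X] (F : X → ℝ≥0∞)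

lemma lipschitzReg_le (k : ℕ) (p : X) : lipschitzReg F k p ≤ min (F p) k :=
  (iInf_le _ p).trans (by simp)

lemma lipschitzReg_le_add (k : ℕ) (p p' : X) :
    lipschitzReg F k p ≤ lipschitzReg F k p' + k * edist p p' := by
  unfold lipschitzReg
  rw [ENNReal.iInf_add]
  refine iInf_mono fun q => ?_
  rw [add_assoc, ← mul_add]
  gcongr
  rw [add_comm]
  exact edist_triangle _ _ _

lemma lipschitzReg_mono (p : X) : Monotone fun k => lipschitzReg F k p := by
  intro j k h
  refine iInf_mono fun q => ?_
  gcongr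

/-- For `y' < F p`, lower semicontinuity keeps `F` above `y'` on a ball around `p`. Points in the
ball do not pull the infimum below `y'`, and points outside it pay a distance penalty that exceeds
`y'` for large `k`. -/
lemma iSup_lipschitzReg {F : X → ℝ≥0∞} (hF : LowerSemicontinuous F) (p : X) :
    ⨆ k, lipschitzReg F k p = F p := by
  refine le_antisymm (iSup_le fun k => (lipschitzReg_le F k p).trans (min_le_left _ _)) ?_
  refine le_of_forall_lt fun y hy => ?_
  obtain ⟨y', hyy', hy'⟩ := exists_between hy
  obtain ⟨δ, hδ, hball⟩ := EMetric.mem_nhds_iff.1 (hF p y' hy')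
  have hy'_top : y' ≠ ⊤ := (hy'.trans_le le_top).ne
  -- The sum makes `k` exceed both `y'`, so that truncation at `k` is harmless inside the ball, and
  -- `y' / δ`, so that the penalty is at least `y'` outside it.
  obtain ⟨k, hk⟩ := ENNReal.exists_nat_gt (r := y' + y' / δ)
    (ENNReal.add_ne_top.2 ⟨hy'_top, (ENNReal.div_lt_top hy'_top hδ.ne').ne⟩)
  refine hyy'.trans_le (le_iSup_of_le k (le_iInf fun q => ?_))
  by_cases hq : q ∈ Metric.eball p δ
  · refine le_add_right (le_min (hball hq).le ?_)
    exact le_self_add.trans hk.le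
  · refine le_add_left ?_
    have h1 : δ ≤ edist p q := by
      rw [edist_comm]; simpa using hq
    have h2 : y' / δ ≤ k := le_add_self.trans hk.le
    rcases eq_or_ne δ ⊤ with rfl | hδ'
    · have : (k : ℝ≥0∞) ≠ 0 := (bot_le.trans_lt hk).ne'
      rw [top_le_iff.1 h1, ENNReal.mul_top this]; exact le_top
    · calc y' ≤ y' / δ * δ := (ENNReal.div_mul_cancel hδ.ne' hδ').ge
        _ ≤ k * edist p q := mul_le_mul' h2 h1

lemma lipschitzReg_ne_top (k : ℕ) (p : X) : lipschitzReg F k p ≠ ⊤ :=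
  (((lipschitzReg_le F k p).trans (min_le_right _ _)).trans_lt (by simp)).ne

lemma continuous_lipschitzReg (k : ℕ) : Continuous (lipschitzReg F k) := by
  refine continuous_of_le_add_edist k (by simp) fun p q => lipschitzReg_le_add F k p q

end LipschitzReg

/-- A Feller Markov kernel maps a jointly lower semicontinuous integrand to a jointly lower
semicontinuous integral. -/
theorem lowerSemicontinuous_lintegral_kernel {X Z : Type*} [PseudoEMetricSpace X]
    [TopologicalSpace Z] [TopologicalSpace.PseudoMetrizableSpace Z] [MeasurableSpace Z]
    [OpensMeasurableSpace Z]
    (P : Kernel Z Z) [IsMarkovKernel P]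
    (feller : ∀ f : Z →ᵇ ℝ, Continuous fun z => ∫ y, f y ∂(P z))
    {F : X × Z → ℝ≥0∞} (hF : LowerSemicontinuous F) :
    LowerSemicontinuous fun p : X × Z => ∫⁻ y, F (p.1, y) ∂(P p.2) := by
  let _ := TopologicalSpace.pseudoMetrizableSpacePseudoMetric Z
  have hcont : ∀ k x, Continuous fun y => lipschitzReg F k (x, y) := fun k x =>
    (continuous_lipschitzReg F k).comp (by fun_prop)
  -- By monotone convergence it suffices to treat each regularization, since a supremum of lower
  -- semicontinuous functions is lower semicontinuous.
  have hsup : (fun p : X × Z => ∫⁻ y, F (p.1, y) ∂(P p.2)) =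
      fun p => ⨆ k, ∫⁻ y, lipschitzReg F k (p.1, y) ∂(P p.2) := by
    funext p
    rw [← lintegral_iSup (fun k => (hcont k p.1).measurable)
      fun j k h y => lipschitzReg_mono F (p.1, y) h]
    simp_rw [iSup_lipschitzReg hF]
  rw [hsup]
  refine lowerSemicontinuous_iSup fun k => ?_
  rintro ⟨x, z⟩ y₀ hy₀
  -- With `x` frozen, the regularized integrand is bounded and continuous, so the Feller property
  -- applies.
  have hz : Continuous fun z => ∫⁻ y, lipschitzReg F k (x, y) ∂(P z) := by
    have hb : ∀ y, ‖(lipschitzReg F k (x, y)).toReal‖ ≤ k := fun y => by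
      rw [Real.norm_of_nonneg ENNReal.toReal_nonneg]
      exact ENNReal.toReal_le_of_le_ofReal (by simp)
        (((lipschitzReg_le F k _).trans (min_le_right _ _)).trans (by simp))
    have hc : Continuous fun y => (lipschitzReg F k (x, y)).toReal :=
      ENNReal.continuousOn_toReal.comp_continuous (hcont k x) fun y => lipschitzReg_ne_top F k _
    have := feller (BoundedContinuousFunction.ofNormedAddCommGroup _ hc k hb)
    have heq : (fun z => ∫⁻ y, lipschitzReg F k (x, y) ∂(P z)) =
        fun z => ENNReal.ofReal (∫ y, (lipschitzReg F k (x, y)).toReal ∂(P z)) := by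
      funext z
      rw [ofReal_integral_eq_lintegral_ofReal]
      · simp_rw [ENNReal.ofReal_toReal (lipschitzReg_ne_top F k _)]
      · exact (integrable_const (k : ℝ)).mono' hc.measurable.aestronglyMeasurable
          (ae_of_all _ hb)
      · exact ae_of_all _ fun _ => ENNReal.toReal_nonneg
    rw [heq]
    exact ENNReal.continuous_ofReal.comp this
  -- The margin between `y₀` and the integral is split at `q`: moving `z` keeps the integral above
  -- `q`, and moving `x` changes the integrand by at most `k * edist x p.1`, uniformly in the
  -- integration variable. This uniformity upgrades the Feller property to joint semicontinuity.
  obtain ⟨q, hq1, hq2⟩ := exists_between hy₀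
  have e1 : ∀ᶠ p : X × Z in 𝓝 (x, z), q < ∫⁻ y, lipschitzReg F k (x, y) ∂(P p.2) :=
    (continuous_snd.tendsto (x, z)).eventually (hz.tendsto z |>.eventually (lt_mem_nhds hq2))
  have e2 : ∀ᶠ p : X × Z in 𝓝 (x, z), k * edist x p.1 < q - y₀ := by
    have : Continuous fun p : X × Z => (k : ℝ≥0∞) * edist x p.1 :=
      (ENNReal.continuous_const_mul (by simp)).comp (by fun_prop)
    refine (this.tendsto (x, z)).eventually (gt_mem_nhds ?_)
    simpa using hq1
  filter_upwards [e1, e2] with p h1 h2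
  have h3 : ∫⁻ y, lipschitzReg F k (x, y) ∂(P p.2) ≤
      ∫⁻ y, lipschitzReg F k (p.1, y) ∂(P p.2) + k * edist x p.1 := by
    calc _ ≤ ∫⁻ y, (lipschitzReg F k (p.1, y) + k * edist x p.1) ∂(P p.2) :=
          lintegral_mono fun y => (lipschitzReg_le_add F k (x, y) (p.1, y)).trans (by
            simp [Prod.edist_eq])
      _ = _ := by rw [lintegral_add_right _ measurable_const]; simp
  have h4 := h1.trans_le h3
  by_contra hlt
  have h5 : q < y₀ + (q - y₀) := h4.trans_le (add_le_add (not_lt.1 hlt) h2.le)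
  rw [add_tsub_cancel_of_le hq1.le] at h5
  exact lt_irrefl _ h5

/-- **Fatou's lemma** as a statement on lower semicontinuity. -/
theorem lowerSemicontinuous_lintegral {X Ω : Type*} [TopologicalSpace X]
    [FirstCountableTopology X] [MeasurableSpace Ω] (μ : Measure Ω) {f : X → Ω → ℝ≥0∞}
    (hm : ∀ x, Measurable (f x)) (hf : ∀ ω, LowerSemicontinuous fun x => f x ω) :
    LowerSemicontinuous fun x => ∫⁻ ω, f x ω ∂μ := by
  intro x
  refine lowerSemicontinuousAt_iff_le_liminf.2 ?_
  exact (lintegral_mono fun ω => LowerSemicontinuousAt.le_liminf (hf ω x)).trans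
    (lintegral_liminf_le hm)

/-- A nonnegative function that is continuous wherever it does not vanish is lower
semicontinuous. -/
theorem lowerSemicontinuous_of_eq_zero_or_continuousAt {X : Type*} [TopologicalSpace X]
    {f : X → ℝ≥0∞} (h : ∀ x, f x = 0 ∨ ContinuousAt f x) : LowerSemicontinuous f := by
  intro x
  rcases h x with h | h
  · intro y hy
    simp [h] at hy
  · exact h.lowerSemicontinuousAt

namespace IncomeFluctuation

variable {Z E H : Type*} [TopologicalSpace Z] [MeasurableSpace Z] [MeasurableSpace E]
  [MeasurableSpace H] {M : IncomeFluctuation Z E H}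

/-! ### Marginal utility -/

lemma marginalE_of_pos {x : ℝ} (hx : 0 < x) : M.marginalE x = ENNReal.ofReal (M.marginal x) :=
  if_pos hx

lemma marginalE_of_nonpos {x : ℝ} (hx : x ≤ 0) : M.marginalE x = ⊤ := if_neg hx.not_gt

lemma marginalE_ne_top {x : ℝ} (hx : 0 < x) : M.marginalE x ≠ ⊤ := by
  simp [marginalE_of_pos hx]

lemma pos_of_marginalE_ne_top {x : ℝ} (hx : M.marginalE x ≠ ⊤) : 0 < x := by
  by_contra h
  exact hx (marginalE_of_nonpos (not_lt.1 h))

namespace UtilityAssumption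

variable (hu : M.UtilityAssumption)
include hu

lemma continuousOn_marginal : ContinuousOn M.marginal (Ioi 0) := fun x hx =>
  (hu.differentiable_marginal x hx).continuousAt.continuousWithinAt

lemma strictAntiOn_marginal : StrictAntiOn M.marginal (Ioi 0) :=
  strictAntiOn_of_deriv_neg (convex_Ioi 0) hu.continuousOn_marginal (by
    simpa using hu.deriv_marginal_neg)

lemma strictAnti_marginalE {x y : ℝ} (hxy : x < y) (hy : 0 < y) :
    M.marginalE y < M.marginalE x := by
  rcases le_or_gt x 0 with hx | hx
  · rw [marginalE_of_nonpos hx]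
    exact (marginalE_ne_top hy).lt_top
  · rw [marginalE_of_pos hx, marginalE_of_pos hy]
    exact (ENNReal.ofReal_lt_ofReal_iff (hu.marginal_pos x hx)).2
      (hu.strictAntiOn_marginal hx hy hxy)

lemma antitone_marginalE : Antitone M.marginalE := by
  intro x y hxy
  rcases le_or_gt y 0 with hy | hy
  · rw [marginalE_of_nonpos (hxy.trans hy)]; exact le_top
  · rcases hxy.eq_or_lt with rfl | h
    · exact le_rfl
    · exact (hu.strictAnti_marginalE h hy).le

lemma continuous_marginalE : Continuous M.marginalE := by
  rw [continuous_iff_continuousAt]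
  intro x
  rcases lt_trichotomy x 0 with hx | rfl | hx
  · have : M.marginalE =ᶠ[𝓝 x] fun _ => ⊤ := by
      filter_upwards [gt_mem_nhds hx] with y hy using marginalE_of_nonpos hy.le
    exact (continuousAt_congr this).2 continuousAt_const
  · rw [ContinuousAt, marginalE_of_nonpos le_rfl, ENNReal.tendsto_nhds_top_iff_nnreal]
    intro r
    have h1 : ∀ᶠ y in 𝓝[>] (0 : ℝ), (r : ℝ) < M.marginal y :=
      hu.marginal_zero.eventually (eventually_gt_atTop _)
    rw [eventually_nhdsWithin_iff] at h1
    filter_upwards [h1] with y hy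
    rcases le_or_gt y 0 with h | h
    · rw [marginalE_of_nonpos h]; exact ENNReal.coe_lt_top
    · rw [marginalE_of_pos h, ← ENNReal.ofReal_coe_nnreal]
      exact (ENNReal.ofReal_lt_ofReal_iff (hu.marginal_pos y h)).2 (hy h)
  · have : M.marginalE =ᶠ[𝓝 x] fun y => ENNReal.ofReal (M.marginal y) := by
      filter_upwards [lt_mem_nhds hx] with y hy using marginalE_of_pos hy
    exact (continuousAt_congr this).2
      (ENNReal.continuous_ofReal.continuousAt.comp
        (hu.differentiable_marginal x hx).continuousAt)

lemma measurable_marginalE : Measurable M.marginalE := hu.continuous_marginalE.measurable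

/-- Intermediate value theorem on `[0, a]`; the value `∞` at `0` bounds every `κ` from above. -/
lemma exists_marginalE_eq {a : ℝ} {κ : ℝ≥0∞} (hκ : κ ≠ ⊤) (ha : 0 < a) (h : M.marginalE a ≤ κ) :
    ∃ x ∈ Ioc 0 a, M.marginalE x = κ := by
  obtain ⟨x, hx, hxκ⟩ := (isPreconnected_Icc (a := (0 : ℝ)) (b := a)).intermediate_value
    (right_mem_Icc.2 ha.le) (left_mem_Icc.2 ha.le) hu.continuous_marginalE.continuousOn
    ⟨h, by rw [marginalE_of_nonpos le_rfl]; exact le_top⟩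
  exact ⟨x, ⟨pos_of_marginalE_ne_top (hxκ ▸ hκ), hx.2⟩, hxκ⟩

/-- A positive solution `r x` of `u'(ξ) = Ψ(ξ, x)` depends continuously on `x` if `Ψ` is increasing
in `ξ` and continuous in `x`. -/
lemma continuous_of_marginalE_eq {X : Type*} [TopologicalSpace X] {Ψ : ℝ → X → ℝ≥0∞}
    (hmono : ∀ x, Monotone fun ξ => Ψ ξ x) (hcont : ∀ ξ, 0 < ξ → Continuous (Ψ ξ)) {r : X → ℝ}
    (hr : ∀ x, 0 < r x) (hroot : ∀ x, M.marginalE (r x) = Ψ (r x) x) : Continuous r := by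
  rw [continuous_iff_continuousAt]
  intro x₀
  refine tendsto_order.2 ⟨fun y hy => ?_, fun y hy => ?_⟩
  · rcases le_or_gt y 0 with h0 | h0
    · exact Eventually.of_forall fun x => h0.trans_lt (hr x)
    -- Since `u'` decreases and `Ψ` increases in `ξ`, the sign of `u'(y) - Ψ(y, x)` tells on which
    -- side of `y` the root lies. A strict sign at `x₀` persists nearby because only `x` varies.
    have h1 : Ψ y x₀ < M.marginalE y :=
      calc Ψ y x₀ ≤ Ψ (r x₀) x₀ := hmono x₀ hy.le
        _ = M.marginalE (r x₀) := (hroot x₀).symm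
        _ < M.marginalE y := hu.strictAnti_marginalE hy (hr x₀)
    filter_upwards [((hcont y h0).tendsto x₀).eventually (gt_mem_nhds h1)] with x hx
    by_contra hle
    have hle := not_lt.1 hle
    exact lt_irrefl _ (calc M.marginalE y ≤ M.marginalE (r x) := hu.antitone_marginalE hle
      _ = Ψ (r x) x := hroot x
      _ ≤ Ψ y x := hmono x hle
      _ < M.marginalE y := hx)
  · have h1 : M.marginalE y < Ψ y x₀ :=
      calc M.marginalE y < M.marginalE (r x₀) := hu.strictAnti_marginalE hy ((hr x₀).trans hy)
        _ = Ψ (r x₀) x₀ := hroot x₀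
        _ ≤ Ψ y x₀ := hmono x₀ hy.le
    filter_upwards [((hcont y ((hr x₀).trans hy)).tendsto x₀).eventually (lt_mem_nhds h1)]
      with x hx
    by_contra hle
    have hle := not_lt.1 hle
    exact lt_irrefl _ (calc M.marginalE y < Ψ y x := hx
      _ ≤ Ψ (r x) x := hmono x hle
      _ = M.marginalE (r x) := (hroot x).symm
      _ ≤ M.marginalE y := hu.antitone_marginalE hle)

/-- `x u'(x) ≤ u'(x) + u'(1) x`. -/
lemma marginalE_mul_le (x : ℝ≥0) :
    M.marginalE x * x ≤ M.marginalE x + M.marginalE 1 * x := by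
  rcases le_total x 1 with h | h
  · refine le_add_right ?_
    calc M.marginalE x * x ≤ M.marginalE x * 1 := by gcongr; exact_mod_cast h
      _ = _ := mul_one _
  · refine le_add_left ?_
    gcongr
    exact hu.antitone_marginalE (by exact_mod_cast h)

/-! ### Concavity of utility -/

lemma utility_eq_coe {x : ℝ} (hx : 0 < x) : M.u x.toNNReal = (M.realUtility x : EReal) :=
  (EReal.coe_toReal (M.u_ne_top _) (hu.finite _ (by simpa using hx))).symm

/-- Mean value theorem, with the slope at the intermediate point compared to the slope at `x` by
strict monotonicity of `u'`. -/
lemma realUtility_lt {x y : ℝ} (hx : 0 < x) (hy : 0 < y) (hxy : x ≠ y) :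
    M.realUtility y < M.realUtility x + M.marginal x * (y - x) := by
  have hd : ∀ s ⊆ Ioi (0 : ℝ), DifferentiableOn ℝ M.realUtility s := fun s hs t ht =>
    (hu.differentiable t (hs ht)).differentiableWithinAt
  rcases lt_or_gt_of_ne hxy with h | h
  · have hs : Icc x y ⊆ Ioi 0 := fun t ht => hx.trans_le ht.1
    obtain ⟨c, hc, hc'⟩ := exists_deriv_eq_slope M.realUtility h (hd _ hs).continuousOn
      (hd _ (Ioo_subset_Icc_self.trans hs))
    have h1 : M.marginal c < M.marginal x :=
      hu.strictAntiOn_marginal hx (hx.trans hc.1) hc.1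
    have h2 : M.realUtility y - M.realUtility x = M.marginal c * (y - x) := by
      rw [marginal, hc', div_mul_cancel₀ _ (sub_pos.2 h).ne']
    nlinarith [mul_lt_mul_of_pos_right h1 (sub_pos.2 h)]
  · have hs : Icc y x ⊆ Ioi 0 := fun t ht => hy.trans_le ht.1
    obtain ⟨c, hc, hc'⟩ := exists_deriv_eq_slope M.realUtility h (hd _ hs).continuousOn
      (hd _ (Ioo_subset_Icc_self.trans hs))
    have h1 : M.marginal x < M.marginal c :=
      hu.strictAntiOn_marginal (hy.trans hc.1) hx hc.2
    have h2 : M.realUtility x - M.realUtility y = M.marginal c * (x - y) := by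
      rw [marginal, hc', div_mul_cancel₀ _ (sub_pos.2 h).ne']
    nlinarith [mul_lt_mul_of_pos_right h1 (sub_pos.2 h)]

lemma realUtility_le {x y : ℝ} (hx : 0 < x) (hy : 0 ≤ y) (hne : M.u y.toNNReal ≠ ⊥) :
    M.realUtility y ≤ M.realUtility x + M.marginal x * (y - x) := by
  have hpos : ∀ y, 0 < y → M.realUtility y ≤ M.realUtility x + M.marginal x * (y - x) := by
    intro y hy
    rcases eq_or_ne x y with rfl | h
    · simp
    · exact (hu.realUtility_lt hx hy h).le
  rcases hy.eq_or_lt with rfl | hy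
  · have hlim : Tendsto (fun ε : ℝ => M.realUtility x + M.marginal x * (ε - x)) (𝓝[>] 0)
        (𝓝 (M.realUtility x + M.marginal x * (0 - x))) :=
      tendsto_nhdsWithin_of_tendsto_nhds (Continuous.tendsto (by fun_prop) 0)
    refine ge_of_tendsto hlim ?_
    filter_upwards [self_mem_nhdsWithin] with ε (hε : 0 < ε)
    refine le_trans ?_ (hpos ε hε)
    refine EReal.toReal_le_toReal ?_ hne (M.u_ne_top _)
    simpa using hu.zero_le ε.toNNReal
  · exact hpos y hy

/-- The tangent inequality `u(y) - u(x) ≤ u'(x) (y - x)` in terms of positive and negative parts. -/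
lemma tangent_le {x y : ℝ} (hx : 0 ≤ x) (hy : 0 ≤ y) :
    (M.u y.toNNReal).toENNReal + (-M.u x.toNNReal).toENNReal + M.marginalE x * ENNReal.ofReal x ≤
      (M.u x.toNNReal).toENNReal + (-M.u y.toNNReal).toENNReal +
        M.marginalE x * ENNReal.ofReal y := by
  rcases hx.eq_or_lt with rfl | hx
  -- At `x = 0` the price `u'(0)` is `∞`: the right side is infinite unless `y = 0`, when the two
  -- sides coincide.
  · rcases hy.eq_or_lt with rfl | hy
    · exact le_rfl
    · rw [marginalE_of_nonpos le_rfl,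
        ENNReal.top_mul (a := ENNReal.ofReal y) (by simpa using hy), add_top]
      exact le_top
  by_cases hbot : M.u y.toNNReal = ⊥
  · simp [hbot]
  have key := hu.realUtility_le hx hy hbot
  have hm := (hu.marginal_pos x hx).le
  have hyu : M.u y.toNNReal = (M.realUtility y : EReal) :=
    (EReal.coe_toReal (M.u_ne_top _) hbot).symm
  rw [hyu, hu.utility_eq_coe hx, marginalE_of_pos hx, ← EReal.coe_neg, ← EReal.coe_neg]
  simp only [EReal.toENNReal_of_ne_top (EReal.coe_ne_top _), EReal.toReal_coe]
  rw [← ENNReal.ofReal_mul hm, ← ENNReal.ofReal_mul hm]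
  simp only [ENNReal.ofReal, ← ENNReal.coe_add, ENNReal.coe_le_coe, ← NNReal.coe_le_coe,
    NNReal.coe_add, Real.coe_toNNReal']
  have e1 := max_eq_left (mul_nonneg hm hx.le)
  have e2 := max_eq_left (mul_nonneg hm hy)
  rw [e1, e2]
  rcases le_total 0 (M.realUtility x) with h1 | h1 <;>
    rcases le_total 0 (M.realUtility y) with h2 | h2 <;>
    simp [h1, h2] <;> nlinarith

/-- The tangent inequality is strict off the point of tangency. -/
lemma tangent_add_le {x y : ℝ} (hx : 0 < x) (hy : 0 < y) (hxy : x ≠ y) :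
    ∃ δ : ℝ≥0∞, δ ≠ 0 ∧
    (M.u y.toNNReal).toENNReal + (-M.u x.toNNReal).toENNReal +
        M.marginalE x * ENNReal.ofReal x + δ ≤
      (M.u x.toNNReal).toENNReal + (-M.u y.toNNReal).toENNReal +
        M.marginalE x * ENNReal.ofReal y := by
  have key := hu.realUtility_lt hx hy hxy
  have hm := (hu.marginal_pos x hx).le
  refine ⟨ENNReal.ofReal (M.realUtility x + M.marginal x * (y - x) - M.realUtility y),
    by simpa using by linarith, ?_⟩
  rw [hu.utility_eq_coe hy, hu.utility_eq_coe hx, marginalE_of_pos hx, ← EReal.coe_neg,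
    ← EReal.coe_neg]
  simp only [EReal.toENNReal_of_ne_top (EReal.coe_ne_top _), EReal.toReal_coe]
  rw [← ENNReal.ofReal_mul hm, ← ENNReal.ofReal_mul hm]
  simp only [ENNReal.ofReal, ← ENNReal.coe_add, ENNReal.coe_le_coe, ← NNReal.coe_le_coe,
    NNReal.coe_add, Real.coe_toNNReal']
  have e1 := max_eq_left (mul_nonneg hm hx.le)
  have e2 := max_eq_left (mul_nonneg hm hy.le)
  rw [e1, e2, max_eq_left (by linarith : 0 ≤ M.realUtility x + M.marginal x * (y - x)
    - M.realUtility y)]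
  rcases le_total 0 (M.realUtility x) with h1 | h1 <;>
    rcases le_total 0 (M.realUtility y) with h2 | h2 <;>
    simp [h1, h2] <;> nlinarith

lemma utility_pos_le {y : ℝ} (hy : 0 ≤ y) :
    (M.u y.toNNReal).toENNReal ≤ (M.u 1).toENNReal + M.marginalE 1 * ENNReal.ofReal y := by
  by_cases hbot : M.u y.toNNReal = ⊥
  · simp [hbot]
  have key := hu.realUtility_le one_pos hy hbot
  have hm := (hu.marginal_pos 1 one_pos).le
  have h1 := hu.utility_eq_coe one_pos
  rw [Real.toNNReal_one] at h1
  rw [← EReal.coe_toReal (M.u_ne_top _) hbot, h1, marginalE_of_pos one_pos]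
  change (EReal.toENNReal (M.realUtility y : EReal)) ≤ _
  simp only [EReal.toENNReal_of_ne_top (EReal.coe_ne_top _), EReal.toReal_coe]
  rw [← ENNReal.ofReal_mul hm]
  refine le_trans ?_ ENNReal.ofReal_add_le
  exact ENNReal.ofReal_le_ofReal (by nlinarith)

/-- The tangent at `x`, evaluated at `1`, gives `u(1) ≤ u(x) + u'(x) (1 - x) ≤ u(x) + u'(x)`. Bounds
on expected marginal utility thus control the negative part of lifetime utility. -/
lemma utility_neg_le (x : ℝ) :
    (-M.u x.toNNReal).toENNReal ≤ (-M.u 1).toENNReal + M.marginalE x := by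
  rcases le_or_gt x 0 with hx | hx
  · rw [marginalE_of_nonpos hx, add_top]; exact le_top
  have h1 := hu.utility_eq_coe one_pos
  rw [Real.toNNReal_one] at h1
  have hm := hu.marginal_pos x hx
  have key := hu.realUtility_le hx zero_le_one (by simp [h1])
  rw [hu.utility_eq_coe hx, h1, marginalE_of_pos hx, ← EReal.coe_neg, ← EReal.coe_neg]
  simp only [EReal.toENNReal_of_ne_top (EReal.coe_ne_top _), EReal.toReal_coe]
  refine le_trans ?_ ENNReal.ofReal_add_le
  exact ENNReal.ofReal_le_ofReal (by nlinarith)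

end UtilityAssumption


/-! ### Policies on all of `ℝ × Z` -/

lemma extend_of_pos {Z : Type*} (c : State Z → ℝ) {a : ℝ} (ha : 0 < a) (z : Z) :
    extend c a z = c (⟨a, ha⟩, z) := dif_pos ha

lemma extend_of_nonpos {Z : Type*} (c : State Z → ℝ) {a : ℝ} (ha : a ≤ 0) (z : Z) :
    extend c a z = 0 :=
  dif_neg ha.not_gt

lemma IsFeasible.extend_nonneg {Z : Type*} [MeasurableSpace Z] {c : State Z → ℝ}
    (hc : IsFeasible c) (a : ℝ) (z : Z) :
    0 ≤ extend c a z := by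
  rcases le_or_gt a 0 with ha | ha
  · rw [extend_of_nonpos c ha]
  · rw [extend_of_pos c ha]; exact (hc.2 _).1

lemma IsFeasible.extend_le {Z : Type*} [MeasurableSpace Z] {c : State Z → ℝ}
    (hc : IsFeasible c) {a : ℝ} (ha : 0 ≤ a) (z : Z) :
    extend c a z ≤ a := by
  rcases ha.eq_or_lt with rfl | ha
  · rw [extend_of_nonpos c le_rfl]
  · rw [extend_of_pos c ha]; exact (hc.2 _).2

lemma IsFeasible.measurable_extend {Z : Type*} [MeasurableSpace Z] {c : State Z → ℝ}
    (hc : IsFeasible c) :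
    Measurable fun p : ℝ × Z => extend c p.1 p.2 := by
  have hs : MeasurableSet {p : ℝ × Z | 0 < p.1} := measurableSet_lt measurable_const measurable_fst
  refine Measurable.dite (s := {p : ℝ × Z | 0 < p.1})
    (f := fun p => c (⟨p.1.1, p.2⟩, p.1.2)) (g := fun _ => 0) ?_ measurable_const hs
  exact hc.1.comp ((measurable_fst.comp measurable_subtype_coe).subtype_mk.prodMk
    (measurable_snd.comp measurable_subtype_coe))

/-! ### Candidate policies -/

namespace Candidate

@[ext]
lemma ext {c d : M.Candidate} (h : ∀ s, c.toFun s = d.toFun s) : c = d := by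
  obtain ⟨f⟩ := c
  obtain ⟨g⟩ := d
  obtain rfl : f = g := funext h
  rfl

variable (c : M.Candidate)

lemma isFeasible [OpensMeasurableSpace (State Z)] : IsFeasible c.toFun :=
  ⟨c.continuous.measurable, fun s => ⟨(c.pos s).le, c.le_assets s⟩⟩

lemma extend_pos {a : ℝ} (ha : 0 < a) (z : Z) : 0 < extend c.toFun a z := by
  rw [extend_of_pos _ ha]; exact c.pos _

lemma extend_nonneg (a : ℝ) (z : Z) : 0 ≤ extend c.toFun a z := by
  rcases le_or_gt a 0 with ha | ha
  · rw [extend_of_nonpos _ ha]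
  · exact (c.extend_pos ha z).le

lemma extend_le_max (a : ℝ) (z : Z) : extend c.toFun a z ≤ max a 0 := by
  rcases le_or_gt a 0 with ha | ha
  · rw [extend_of_nonpos _ ha]; exact le_max_right _ _
  · rw [extend_of_pos _ ha]; exact (c.le_assets _).trans (le_max_left _ _)

lemma extend_mono (z : Z) : Monotone fun a => extend c.toFun a z := by
  intro a b hab
  rcases le_or_gt a 0 with ha | ha
  · simp only [extend_of_nonpos _ ha]
    exact c.extend_nonneg b z
  · simp only [extend_of_pos _ ha, extend_of_pos _ (ha.trans_le hab)]
    exact c.monotone z hab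

/-- At the boundary `a = 0` continuity is forced by `0 ≤ c(a, z) ≤ a`. -/
lemma continuous_extend : Continuous fun p : ℝ × Z => extend c.toFun p.1 p.2 := by
  rw [continuous_iff_continuousAt]
  rintro ⟨a, z⟩
  rcases le_or_gt a 0 with ha | ha
  · rw [ContinuousAt]
    simp only [extend_of_nonpos _ ha]
    have hlim : Tendsto (fun p : ℝ × Z => max p.1 0) (𝓝 (a, z)) (𝓝 0) := by
      have : Continuous fun p : ℝ × Z => max p.1 0 := by fun_prop
      simpa [ha] using this.tendsto (a, z)
    exact squeeze_zero (fun p => c.extend_nonneg _ _) (fun p => c.extend_le_max _ _) hlim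
  · have hopen : IsOpen {p : ℝ × Z | 0 < p.1} := isOpen_lt continuous_const continuous_fst
    have hon : ContinuousOn (fun p : ℝ × Z => extend c.toFun p.1 p.2) {p | 0 < p.1} := by
      rw [continuousOn_iff_continuous_domRestrict]
      have : ({p : ℝ × Z | 0 < p.1}.domRestrict fun p : ℝ × Z => extend c.toFun p.1 p.2) =
          fun p => c.toFun (⟨p.1.1, p.2⟩, p.1.2) :=
        funext fun p => extend_of_pos _ p.2 _
      rw [this]
      exact c.continuous.comp (by fun_prop)
    exact hon.continuousAt (hopen.mem_nhds ha)

/-- The boundedness clause of `𝒞` in the form used by the integral estimates; at `a ≤ 0` both sides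
are `∞`. -/
lemma exists_marginalE_extend_le :
    ∃ K : ℝ≥0, ∀ a z, M.marginalE (extend c.toFun a z) ≤ M.marginalE a + K := by
  obtain ⟨K, hK⟩ := c.bounded
  refine ⟨K.toNNReal, fun a z => ?_⟩
  rcases le_or_gt a 0 with ha | ha
  · rw [marginalE_of_nonpos ha, top_add]; exact le_top
  · rw [marginalE_of_pos ha, marginalE_of_pos (c.extend_pos ha z), extend_of_pos _ ha]
    refine le_trans (ENNReal.ofReal_le_ofReal ?_) ENNReal.ofReal_add_le
    have := (abs_le.1 (hK (⟨a, ha⟩, z))).2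
    linarith

/-! ### The metric on candidate policies -/

lemma marginal_le (hu : M.UtilityAssumption) (s : State Z) :
    M.marginal s.1 ≤ M.marginal (c.toFun s) :=
  hu.strictAntiOn_marginal.antitoneOn (c.pos s) s.1.2 (c.le_assets s)

/-- `u' ∘ c - u'` as a bounded continuous function. -/
def excess (hu : M.UtilityAssumption) : State Z →ᵇ ℝ :=
  BoundedContinuousFunction.ofNormedAddCommGroup
    (fun s => M.marginal (c.toFun s) - M.marginal s.1)
    ((hu.continuousOn_marginal.comp_continuous c.continuous c.pos).sub
      (hu.continuousOn_marginal.comp_continuous (continuous_subtype_val.comp continuous_fst)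
        fun s => s.1.2))
    c.bounded.choose c.bounded.choose_spec

lemma excess_apply (hu : M.UtilityAssumption) (s : State Z) :
    c.excess hu s = M.marginal (c.toFun s) - M.marginal s.1 := rfl

lemma excess_injective (hu : M.UtilityAssumption) :
    Function.Injective fun c : M.Candidate => c.excess hu := by
  intro c d h
  ext s
  have h1 : c.excess hu s = d.excess hu s := by simp only at h; rw [h]
  rw [excess_apply, excess_apply] at h1
  exact hu.strictAntiOn_marginal.injOn (c.pos s) (d.pos s) (by linarith)

lemma edist_excess (hu : M.UtilityAssumption) (c d : M.Candidate) :
    edist (c.excess hu) (d.excess hu) = rho c d := by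
  rw [BoundedContinuousFunction.edist_eq_iSup, rho]
  congr with s
  rw [edist_dist, Real.dist_eq, excess_apply, excess_apply]
  congr 2
  ring

/-- Nonnegativity of `h` encodes `c ≤ a`, and monotonicity of `h + u'` in assets encodes that `c` is
increasing. Conversely `c` is recovered by inverting `u'` at `h + u'(a)`. Both conditions survive
uniform limits. -/
lemma range_excess (hu : M.UtilityAssumption) :
    range (fun c : M.Candidate => c.excess hu) =
      {h | (∀ s, 0 ≤ h s) ∧ ∀ (z : Z) (a b : Ioi (0 : ℝ)), a ≤ b →
        h (b, z) + M.marginal b ≤ h (a, z) + M.marginal a} := by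
  ext h
  constructor
  · rintro ⟨c, rfl⟩
    refine ⟨fun s => by simpa [excess_apply] using c.marginal_le hu s, fun z a b hab => ?_⟩
    simpa [excess_apply] using
      hu.strictAntiOn_marginal.antitoneOn (c.pos (a, z)) (c.pos (b, z)) (c.monotone z hab)
  · rintro ⟨h0, hanti⟩
    have hroot : ∀ s : State Z, ∃ x ∈ Ioc 0 s.1.1,
        M.marginalE x = ENNReal.ofReal (h s + M.marginal s.1) := fun s =>
      hu.exists_marginalE_eq (by simp) s.1.2 (by
        rw [marginalE_of_pos s.1.2]
        exact ENNReal.ofReal_le_ofReal (by linarith [h0 s]))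
    choose r hr hrE using hroot
    have hr0 : ∀ s, 0 < r s := fun s => (hr s).1
    have hrm : ∀ s, M.marginal (r s) = h s + M.marginal s.1 := fun s => by
      have h1 := hrE s
      rw [marginalE_of_pos (hr0 s)] at h1
      exact (ENNReal.ofReal_eq_ofReal_iff (hu.marginal_pos _ (hr0 s)).le
        (add_nonneg (h0 s) (hu.marginal_pos _ s.1.2).le)).1 h1
    -- The root lemma with `Ψ` constant in `ξ` serves as continuity of the inverse of `u'`.
    have hcont : Continuous r :=
      hu.continuous_of_marginalE_eq (Ψ := fun _ s => ENNReal.ofReal (h s + M.marginal s.1))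
        (fun s => monotone_const)
        (fun ξ _ => ENNReal.continuous_ofReal.comp (h.continuous.add
          (hu.continuousOn_marginal.comp_continuous (continuous_subtype_val.comp continuous_fst)
            fun s => s.1.2))) hr0 hrE
    let c : M.Candidate :=
      { toFun := r
        continuous := hcont
        monotone := fun z a b hab => by
          have h1 := hanti z a b hab
          rw [← hrm (b, z), ← hrm (a, z)] at h1
          exact (hu.strictAntiOn_marginal.le_iff_ge (hr0 (b, z)) (hr0 (a, z))).1 h1
        pos := hr0
        le_assets := fun s => (hr s).2
        bounded := ⟨‖h‖, fun s => by
          rw [hrm, add_sub_cancel_right]; exact h.norm_coe_le_norm s⟩ }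
    refine ⟨c, ?_⟩
    ext s
    rw [excess_apply]
    change M.marginal (r s) - _ = _
    rw [hrm, add_sub_cancel_right]

lemma isClosed_range_excess (hu : M.UtilityAssumption) :
    IsClosed (range fun c : M.Candidate => c.excess hu) := by
  have hev : ∀ s : State Z, Continuous fun h : State Z →ᵇ ℝ => h s := fun s => by fun_prop
  rw [range_excess]
  simp only [ofPred_and, ofPred_forall]
  refine IsClosed.inter (isClosed_iInter fun s => isClosed_le continuous_const (hev s)) ?_
  refine isClosed_iInter fun z => isClosed_iInter fun a => isClosed_iInter fun b =>
    isClosed_iInter fun _ => ?_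
  exact isClosed_le ((hev _).add continuous_const) ((hev _).add continuous_const)

theorem exists_completeSpace (hu : M.UtilityAssumption) :
    ∃ D : MetricSpace M.Candidate, (∀ c d : M.Candidate, edist c d = rho c d) ∧
      @CompleteSpace M.Candidate D.toUniformSpace := by
  let D : MetricSpace M.Candidate :=
    MetricSpace.induced (fun c => c.excess hu) (excess_injective hu) inferInstance
  have hiso : Isometry fun c : M.Candidate => c.excess hu := fun _ _ => rfl
  refine ⟨D, fun c d => edist_excess hu c d, ?_⟩
  exact (completeSpace_iff_isComplete_range hiso.isUniformInducing).2
    (isClosed_range_excess hu).isComplete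

/-- One-sided additive bounds in `[0, ∞]` pass through expectations without integrability
conditions. -/
lemma rho_le_iff (hu : M.UtilityAssumption) {c d : M.Candidate} {r : ℝ≥0∞} :
    rho c d ≤ r ↔ ∀ s, M.marginalE (c.toFun s) ≤ M.marginalE (d.toFun s) + r ∧
      M.marginalE (d.toFun s) ≤ M.marginalE (c.toFun s) + r := by
  rw [rho, iSup_le_iff]
  refine forall_congr' fun s => ?_
  have hc := (hu.marginal_pos _ (c.pos s)).le
  have hd := (hu.marginal_pos _ (d.pos s)).le
  rw [marginalE_of_pos (c.pos s), marginalE_of_pos (d.pos s), ← tsub_le_iff_left,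
    ← tsub_le_iff_left, ← ENNReal.ofReal_sub _ hd, ← ENNReal.ofReal_sub _ hc]
  rcases le_total (M.marginal (c.toFun s)) (M.marginal (d.toFun s)) with h | h
  · rw [abs_of_nonpos (sub_nonpos.2 h), neg_sub,
      ENNReal.ofReal_of_nonpos (p := M.marginal (c.toFun s) - _) (sub_nonpos.2 h)]
    simp
  · rw [abs_of_nonneg (sub_nonneg.2 h),
      ENNReal.ofReal_of_nonpos (p := M.marginal (d.toFun s) - _) (sub_nonpos.2 h)]
    simp

/-- The policy of consuming all assets. -/
def consumeAll (M : IncomeFluctuation Z E H) : M.Candidate where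
  toFun s := s.1
  continuous := by fun_prop
  monotone _ _ _ h := h
  pos s := s.1.2
  le_assets _ := le_rfl
  bounded := ⟨0, by simp⟩

end Candidate


/-! ### Expectations over next period's shocks -/

instance : IsMarkovKernel M.shockKernel := by
  unfold shockKernel
  infer_instance

lemma lintegral_shockKernel {f : Z × E × H → ℝ≥0∞} (hf : Measurable f) (z : Z) :
    ∫⁻ w, f w ∂(M.shockKernel z) = ∫⁻ y, ∫⁻ e, f (y, e) ∂(M.ν.prod M.μ) ∂(M.P z) := by
  rw [shockKernel, Kernel.prod_apply, Kernel.const_apply, lintegral_prod _ hf.aemeasurable]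

lemma measurable_return : Measurable fun w : Z × E × H => (M.R (w.1, w.2.1) : ℝ≥0∞) :=
  (M.measurable_R.comp (by fun_prop)).coe_nnreal_ennreal

lemma measurable_income : Measurable fun w : Z × E × H => (M.Y (w.1, w.2.2) : ℝ≥0∞) :=
  (M.measurable_Y.comp (by fun_prop)).coe_nnreal_ennreal

/-- The operator `γ ↦ E_z R̂ γ(ẑ)`. -/
def returnOp (M : IncomeFluctuation Z E H) (γ : Z → ℝ≥0∞) (z : Z) : ℝ≥0∞ :=
  ∫⁻ w, (M.R (w.1, w.2.1) : ℝ≥0∞) * γ w.1 ∂(M.shockKernel z)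

lemma measurable_returnOp {γ : Z → ℝ≥0∞} (hγ : Measurable γ) : Measurable (M.returnOp γ) :=
  (measurable_return.mul (hγ.comp measurable_fst)).lintegral_kernel

lemma measurable_returnOp_iterate {γ : Z → ℝ≥0∞} (hγ : Measurable γ) (k : ℕ) :
    Measurable (M.returnOp^[k] γ) := by
  induction k with
  | zero => exact hγ
  | succ k ih => rw [Function.iterate_succ_apply']; exact measurable_returnOp ih

lemma returnOp_mono : Monotone M.returnOp := fun γ δ h z =>
  lintegral_mono fun w => by gcongr; exact h w.1

lemma returnOp_const_mul {r : ℝ≥0∞} {γ : Z → ℝ≥0∞} (hγ : Measurable γ) :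
    M.returnOp (fun z => r * γ z) = fun z => r * M.returnOp γ z := by
  funext z
  have hm : Measurable fun w : Z × E × H => (M.R (w.1, w.2.1) : ℝ≥0∞) * γ w.1 :=
    measurable_return.mul (hγ.comp measurable_fst)
  rw [returnOp, returnOp, ← lintegral_const_mul r hm]
  simp_rw [mul_left_comm]

lemma returnOp_iterate_const_mul {r : ℝ≥0∞} {γ : Z → ℝ≥0∞} (hγ : Measurable γ) (k : ℕ) :
    M.returnOp^[k] (fun z => r * γ z) = fun z => r * (M.returnOp^[k] γ) z := by
  induction k with
  | zero => rfl
  | succ k ih =>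
    rw [Function.iterate_succ_apply', ih, Function.iterate_succ_apply',
      returnOp_const_mul (measurable_returnOp_iterate hγ k)]

lemma returnOp_one : M.returnOp (fun _ => 1) = M.meanReturn := by
  funext z
  simp [returnOp, meanReturn]

/-- `E_z R̂ (u' ∘ c)(R̂ x + Ŷ, ẑ)`. -/
def eulerMean (M : IncomeFluctuation Z E H) (c : State Z → ℝ) (x : ℝ) (z : Z) : ℝ≥0∞ :=
  ∫⁻ w, (M.R (w.1, w.2.1) : ℝ≥0∞) *
    M.marginalE (extend c (M.R (w.1, w.2.1) * x + M.Y (w.1, w.2.2)) w.1) ∂(M.shockKernel z)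

lemma psi_eq (c : State Z → ℝ) (ξ a : ℝ) (z : Z) :
    M.psi c ξ a z = max (M.β * M.eulerMean c (a - ξ) z) (M.marginalE a) := rfl

lemma eulerMean_antitone (hu : M.UtilityAssumption) (c : M.Candidate) (z : Z) :
    Antitone fun x => M.eulerMean c.toFun x z := by
  intro x y hxy
  refine lintegral_mono fun w => ?_
  dsimp only
  gcongr
  refine hu.antitone_marginalE (c.extend_mono _ ?_)
  gcongr

/-- With nonnegative savings, next period's assets are at least `Ŷ`. The bound does not depend on
`x`, so it dominates uniformly. -/
lemma eulerIntegrand_le (hu : M.UtilityAssumption) (c : M.Candidate) {K : ℝ≥0}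
    (hK : ∀ a z, M.marginalE (extend c.toFun a z) ≤ M.marginalE a + K) {x : ℝ} (hx : 0 ≤ x)
    (w : Z × E × H) :
    M.marginalE (extend c.toFun (M.R (w.1, w.2.1) * x + M.Y (w.1, w.2.2)) w.1) ≤
      M.marginalE (M.Y (w.1, w.2.2)) + K := by
  refine (hK _ _).trans (add_le_add_left (hu.antitone_marginalE ?_) _)
  have : 0 ≤ (M.R (w.1, w.2.1) : ℝ) * x := by positivity
  linarith

lemma measurable_eulerIntegrand [OpensMeasurableSpace (State Z)]
    (hu : M.UtilityAssumption) (c : M.Candidate) :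
    Measurable fun p : ℝ × Z × E × H => (M.R (p.2.1, p.2.2.1) : ℝ≥0∞) *
      M.marginalE (extend c.toFun (M.R (p.2.1, p.2.2.1) * p.1 + M.Y (p.2.1, p.2.2.2)) p.2.1) := by
  refine (measurable_return.comp measurable_snd).mul (hu.measurable_marginalE.comp ?_)
  have hR : Measurable fun p : ℝ × Z × E × H => (M.R (p.2.1, p.2.2.1) : ℝ) :=
    (M.measurable_R.comp (by fun_prop)).coe_nnreal_real
  have hY : Measurable fun p : ℝ × Z × E × H => (M.Y (p.2.1, p.2.2.2) : ℝ) :=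
    (M.measurable_Y.comp (by fun_prop)).coe_nnreal_real
  exact c.isFeasible.measurable_extend.comp
    (((hR.mul measurable_fst).add hY).prodMk (measurable_fst.comp measurable_snd))

lemma measurable_marginalIncome (hu : M.UtilityAssumption) :
    Measurable fun w : Z × E × H => M.marginalE (M.Y (w.1, w.2.2)) :=
  hu.measurable_marginalE.comp (M.measurable_Y.comp (by fun_prop)).coe_nnreal_real

/-- `E_z R̂ (u'(Ŷ) + K)`, an upper bound of `eulerMean`. -/
def eulerBound (M : IncomeFluctuation Z E H) (K : ℝ≥0) (z : Z) : ℝ≥0∞ :=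
  ∫⁻ w, (M.R (w.1, w.2.1) : ℝ≥0∞) * (M.marginalE (M.Y (w.1, w.2.2)) + K) ∂(M.shockKernel z)

lemma eulerBound_eq (hu : M.UtilityAssumption) (K : ℝ≥0) (z : Z) :
    M.eulerBound K z = M.meanReturnMarginalIncome z + K * M.meanReturn z := by
  simp_rw [eulerBound, meanReturnMarginalIncome, meanReturn, mul_add]
  have hm : Measurable fun w : Z × E × H =>
      (M.R (w.1, w.2.1) : ℝ≥0∞) * M.marginalE (M.Y (w.1, w.2.2)) :=
    measurable_return.mul (measurable_marginalIncome hu)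
  rw [lintegral_add_left hm,
    lintegral_mul_const _ measurable_return, mul_comm (K : ℝ≥0∞)]

lemma eulerMean_le (hu : M.UtilityAssumption) (c : M.Candidate) {K : ℝ≥0}
    (hK : ∀ a z, M.marginalE (extend c.toFun a z) ≤ M.marginalE a + K) {x : ℝ} (hx : 0 ≤ x)
    (z : Z) : M.eulerMean c.toFun x z ≤ M.eulerBound K z :=
  lintegral_mono fun w => by
    gcongr
    exact eulerIntegrand_le hu c hK hx w

lemma exists_eulerBound_le (hu : M.UtilityAssumption) (hmom : M.MomentAssumption) (K : ℝ≥0) :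
    ∃ B : ℝ≥0, ∀ z, M.eulerBound K z ≤ B := by
  have hB : (⨆ z, M.meanReturnMarginalIncome z) + K * ⨆ z, M.meanReturn z ≠ ⊤ :=
    ENNReal.add_ne_top.2 ⟨hmom.mean_return_marginal.ne,
      ENNReal.mul_ne_top ENNReal.coe_ne_top hmom.mean_return.ne⟩
  lift (⨆ z, M.meanReturnMarginalIncome z) + K * ⨆ z, M.meanReturn z to ℝ≥0 using hB with B hB'
  refine ⟨B, fun z => ?_⟩
  rw [eulerBound_eq hu, hB']
  gcongr
  · exact le_iSup M.meanReturnMarginalIncome z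
  · exact le_iSup M.meanReturn z

/-! ### Joint continuity of the expected marginal return to saving -/

section Continuity

variable [TopologicalSpace.PseudoMetrizableSpace Z] [BorelSpace Z]

/-- The innovations have a fixed law and are integrated out by Fatou's lemma; what remains is an
integral against the Feller kernel. -/
lemma lowerSemicontinuous_lintegral_shockKernel {f : ℝ → Z × E × H → ℝ≥0∞}
    (hm : ∀ x, Measurable (f x))
    (hf : ∀ e : E × H, LowerSemicontinuous fun p : ℝ × Z => f p.1 (p.2, e)) :
    LowerSemicontinuous fun p : ℝ × Z => ∫⁻ w, f p.1 w ∂(M.shockKernel p.2) := by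
  simp_rw [lintegral_shockKernel (hm _)]
  refine lowerSemicontinuous_lintegral_kernel M.P M.feller
    (F := fun p : ℝ × Z => ∫⁻ e, f p.1 (p.2, e) ∂(M.ν.prod M.μ)) ?_
  exact lowerSemicontinuous_lintegral _
    (fun p => (hm p.1).comp (measurable_const.prodMk measurable_id)) hf

/-- A generalized dominated convergence argument. With `f ≤ g` the integrand and its bound, the
means of `R̂ f` and of `R̂ (g - f)` are both lower semicontinuous, and they add up to `eulerBound`,
which is finite and continuous. Hence each is also upper semicontinuous. The truncation `max p.1 0`
keeps savings in the range where `f ≤ g` holds. -/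
lemma continuous_eulerMean [SecondCountableTopology Z] (hu : M.UtilityAssumption)
    (hmom : M.MomentAssumption) (hcont : M.ContinuityAssumption) (c : M.Candidate) :
    Continuous fun p : ℝ × Z => M.eulerMean c.toFun (max p.1 0) p.2 := by
  obtain ⟨K, hK⟩ := c.exists_marginalE_extend_le
  obtain ⟨B, hB⟩ := exists_eulerBound_le hu hmom K
  let f : ℝ → Z × E × H → ℝ≥0∞ := fun x w =>
    M.marginalE (extend c.toFun (M.R (w.1, w.2.1) * max x 0 + M.Y (w.1, w.2.2)) w.1)
  let g : Z × E × H → ℝ≥0∞ := fun w => M.marginalE (M.Y (w.1, w.2.2)) + K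
  have hfg : ∀ x w, f x w ≤ g w := fun x w => eulerIntegrand_le hu c hK (le_max_right x 0) w
  have hRc : ∀ e : E × H, Continuous fun p : ℝ × Z => (M.R (p.2, e.1) : ℝ≥0∞) := fun e =>
    ENNReal.continuous_coe.comp ((hcont.continuous_R e.1).comp continuous_snd)
  have hfc : ∀ e : E × H, Continuous fun p : ℝ × Z => f p.1 (p.2, e) := fun e => by
    have h1 : Continuous fun p : ℝ × Z => (M.R (p.2, e.1) : ℝ) :=
      NNReal.continuous_coe.comp ((hcont.continuous_R e.1).comp continuous_snd)
    have h2 : Continuous fun p : ℝ × Z => (M.Y (p.2, e.2) : ℝ) :=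
      NNReal.continuous_coe.comp ((hcont.continuous_Y e.2).comp continuous_snd)
    exact hu.continuous_marginalE.comp (c.continuous_extend.comp
      (((h1.mul (by fun_prop)).add h2).prodMk continuous_snd))
  have hgc : ∀ e : E × H, Continuous fun p : ℝ × Z => g (p.2, e) := fun e =>
    (hu.continuous_marginalE.comp
      (NNReal.continuous_coe.comp ((hcont.continuous_Y e.2).comp continuous_snd))).add
      continuous_const
  have hRfm : ∀ x, Measurable fun w : Z × E × H => (M.R (w.1, w.2.1) : ℝ≥0∞) * f x w := fun x =>
    (measurable_eulerIntegrand hu c).comp (measurable_const.prodMk measurable_id)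
  have hfm : ∀ x, Measurable (f x) := fun x => by
    have hR : Measurable fun w : Z × E × H => (M.R (w.1, w.2.1) : ℝ) :=
      (M.measurable_R.comp (by fun_prop)).coe_nnreal_real
    have hY : Measurable fun w : Z × E × H => (M.Y (w.1, w.2.2) : ℝ) :=
      (M.measurable_Y.comp (by fun_prop)).coe_nnreal_real
    exact hu.measurable_marginalE.comp (c.continuous_extend.measurable.comp
      (((hR.mul measurable_const).add hY).prodMk measurable_fst))
  have hgm : Measurable g := (measurable_marginalIncome hu).add measurable_const
  have hlow : LowerSemicontinuous fun p : ℝ × Z => M.eulerMean c.toFun (max p.1 0) p.2 := by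
    refine lowerSemicontinuous_lintegral_shockKernel hRfm fun e => ?_
    refine lowerSemicontinuous_of_eq_zero_or_continuousAt fun p => ?_
    -- Multiplication on `[0, ∞]` is discontinuous at `(0, ∞)`, but there the product is `0`, where
    -- lower semicontinuity is automatic.
    by_cases hR : (M.R (p.2, e.1) : ℝ≥0∞) = 0
    · left; simp only [hR, zero_mul]
    · right
      exact ENNReal.Tendsto.mul ((hRc e).tendsto p) (.inl hR) ((hfc e).tendsto p)
        (.inr ENNReal.coe_ne_top)
  have hlow' : LowerSemicontinuous fun p : ℝ × Z =>
      ∫⁻ w, (M.R (w.1, w.2.1) : ℝ≥0∞) * (g w - f p.1 w) ∂(M.shockKernel p.2) := by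
    refine lowerSemicontinuous_lintegral_shockKernel
      (f := fun x w => (M.R (w.1, w.2.1) : ℝ≥0∞) * (g w - f x w))
      (fun x => measurable_return.mul (hgm.sub (hfm x))) fun e => ?_
    refine lowerSemicontinuous_of_eq_zero_or_continuousAt fun p => ?_
    by_cases hR : (M.R (p.2, e.1) : ℝ≥0∞) = 0
    · left; simp only [hR, zero_mul]
    -- Subtraction is discontinuous at `(∞, ∞)`, where truncated subtraction again gives `0`.
    by_cases hf : f p.1 (p.2, e) = ⊤
    · left; simp only [hf, tsub_eq_zero_of_le le_top, mul_zero]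
    · right
      exact ENNReal.Tendsto.mul ((hRc e).tendsto p) (.inl hR)
        (ENNReal.Tendsto.sub ((hgc e).tendsto p) ((hfc e).tendsto p) (.inr hf))
        (.inr ENNReal.coe_ne_top)
  have hsum : ∀ p : ℝ × Z, M.eulerMean c.toFun (max p.1 0) p.2 +
      ∫⁻ w, (M.R (w.1, w.2.1) : ℝ≥0∞) * (g w - f p.1 w) ∂(M.shockKernel p.2) =
        M.eulerBound K p.2 := by
    intro p
    rw [eulerMean, ← lintegral_add_left (hRfm p.1), eulerBound]
    refine lintegral_congr fun w => ?_
    rw [← mul_add]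
    congr 1
    exact add_tsub_cancel_of_le (hfg p.1 w)
  have hbc : Continuous (M.eulerBound K) := by
    rw [funext (eulerBound_eq hu K)]
    exact hcont.continuous_meanReturnMarginal.add
      ((ENNReal.continuous_const_mul ENNReal.coe_ne_top).comp hcont.continuous_meanReturn)
  refine continuous_iff_lower_upperSemicontinuous.2 ⟨hlow, fun p₀ y hy => ?_⟩
  have h0 : M.eulerBound K p₀.2 <
      y + ∫⁻ w, (M.R (w.1, w.2.1) : ℝ≥0∞) * (g w - f p₀.1 w) ∂(M.shockKernel p₀.2) := by
    have hle : ∫⁻ w, (M.R (w.1, w.2.1) : ℝ≥0∞) * (g w - f p₀.1 w) ∂(M.shockKernel p₀.2) ≠ ⊤ :=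
      ((le_add_self.trans (hsum p₀).le).trans_lt ((hB _).trans_lt ENNReal.coe_lt_top)).ne
    rw [← hsum p₀]
    exact ENNReal.add_lt_add_right hle hy
  obtain ⟨q, hq1, hq2⟩ := exists_between h0
  have e1 : ∀ᶠ p : ℝ × Z in 𝓝 p₀, M.eulerBound K p.2 < q :=
    ((hbc.comp continuous_snd).tendsto p₀).eventually (gt_mem_nhds hq1)
  have e2 := (lowerSemicontinuous_const (z := y)).add hlow' p₀ q hq2
  filter_upwards [e1, e2] with p h1 h2
  have h3 := h1.trans h2
  rw [← hsum p] at h3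
  exact lt_of_add_lt_add_right h3

end Continuity


/-! ### The Coleman operator -/

lemma psi_mono (hu : M.UtilityAssumption) (c : M.Candidate) (a : ℝ) (z : Z) :
    Monotone fun ξ => M.psi c.toFun ξ a z := by
  intro ξ ξ' h
  simp only [psi_eq]
  gcongr
  exact eulerMean_antitone hu c z (by linarith)

lemma root_unique (hu : M.UtilityAssumption) (c : M.Candidate) {a : ℝ} {z : Z} {ξ ξ' : ℝ}
    (hξ : 0 < ξ) (hξ' : 0 < ξ')
    (h : M.marginalE ξ = M.psi c.toFun ξ a z) (h₂ : M.marginalE ξ' = M.psi c.toFun ξ' a z) :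
    ξ = ξ' := by
  have key : ∀ x y : ℝ, 0 < y → M.marginalE x = M.psi c.toFun x a z →
      M.marginalE y = M.psi c.toFun y a z → ¬ x < y := fun x y hy hx hy' hlt => by
    have h1 := hu.strictAnti_marginalE hlt hy
    rw [hx, hy'] at h1
    exact h1.not_ge (psi_mono hu c a z hlt.le)
  exact le_antisymm (not_lt.1 (key _ _ hξ h₂ h)) (not_lt.1 (key _ _ hξ' h h₂))

/-- `psi` with savings truncated at `0`, which makes it a continuous function of all arguments. -/
def psiTrunc (M : IncomeFluctuation Z E H) (c : State Z → ℝ) (ξ : ℝ) (s : State Z) : ℝ≥0∞ :=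
  max (M.β * M.eulerMean c (max (s.1 - ξ) 0) s.2) (M.marginalE s.1)

lemma psiTrunc_eq (c : State Z → ℝ) {ξ : ℝ} {s : State Z} (h : ξ ≤ s.1) :
    M.psiTrunc c ξ s = M.psi c ξ s.1 s.2 := by
  rw [psiTrunc, psi_eq, max_eq_left (sub_nonneg.2 h)]

/-- This uniform bound makes the crossing point positive and keeps `u' ∘ Tc - u'` bounded. -/
lemma psiTrunc_le (hu : M.UtilityAssumption) (hmom : M.MomentAssumption) (c : M.Candidate) :
    ∃ B : ℝ≥0, ∀ ξ s, M.psiTrunc c.toFun ξ s ≤ M.marginalE s.1 + B := by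
  obtain ⟨K, hK⟩ := c.exists_marginalE_extend_le
  obtain ⟨B, hB⟩ := exists_eulerBound_le hu hmom K
  refine ⟨M.β * B, fun ξ s => max_le (le_add_left ?_) le_self_add⟩
  push_cast
  gcongr
  exact (eulerMean_le hu c hK (le_max_right _ _) _).trans (hB _)

lemma psiTrunc_mono (hu : M.UtilityAssumption) (c : M.Candidate) (s : State Z) :
    Monotone fun ξ => M.psiTrunc c.toFun ξ s := by
  intro ξ ξ' h
  simp only [psiTrunc]
  gcongr
  refine eulerMean_antitone hu c s.2 ?_
  gcongr

lemma psiTrunc_anti (hu : M.UtilityAssumption) (c : M.Candidate) (ξ : ℝ) (z : Z) :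
    Antitone fun a : Ioi (0 : ℝ) => M.psiTrunc c.toFun ξ (a, z) := by
  intro a b h
  have h' : (a : ℝ) ≤ b := h
  refine max_le_max ?_ (hu.antitone_marginalE h')
  gcongr
  refine eulerMean_antitone hu c z ?_
  dsimp only
  gcongr

section Coleman

variable [TopologicalSpace.PseudoMetrizableSpace Z] [SecondCountableTopology Z] [BorelSpace Z]

lemma continuous_psiTrunc (hu : M.UtilityAssumption) (hmom : M.MomentAssumption)
    (hcont : M.ContinuityAssumption) (c : M.Candidate) :
    Continuous fun p : ℝ × State Z => M.psiTrunc c.toFun p.1 p.2 := by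
  have h1 : Continuous fun p : ℝ × State Z => ((p.2.1 : ℝ) - p.1, p.2.2) := by fun_prop
  have h2 := (continuous_eulerMean hu hmom hcont c).comp h1
  have h3 : Continuous fun p : ℝ × State Z => M.marginalE p.2.1 :=
    hu.continuous_marginalE.comp (by fun_prop)
  exact ((ENNReal.continuous_const_mul (ENNReal.coe_ne_top (r := M.β))).comp h2).max h3

/-- Intermediate value theorem on `[0, a]`: at `0` the left side is `∞`, and at `a` the right side
is at least `u'(a)`. Finiteness of the right side excludes the root `0`. -/
lemma exists_root (hu : M.UtilityAssumption) (hmom : M.MomentAssumption)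
    (hcont : M.ContinuityAssumption) (c : M.Candidate) (s : State Z) :
    ∃ ξ ∈ Ioc (0 : ℝ) s.1, M.marginalE ξ = M.psiTrunc c.toFun ξ s := by
  have ha : (0 : ℝ) < s.1 := s.1.2
  obtain ⟨B, hB⟩ := psiTrunc_le hu hmom c
  have hpair : Continuous fun ξ : ℝ => (ξ, s) := by fun_prop
  have hc := (continuous_psiTrunc hu hmom hcont c).comp hpair
  have hle : M.marginalE s.1 ≤ M.psiTrunc c.toFun s.1 s := le_max_right _ _
  obtain ⟨ξ, hξ, h⟩ := (isPreconnected_Icc (a := (0 : ℝ)) (b := s.1)).intermediate_value₂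
    (right_mem_Icc.2 ha.le) (left_mem_Icc.2 ha.le) hu.continuous_marginalE.continuousOn
    hc.continuousOn hle (by rw [marginalE_of_nonpos le_rfl]; exact le_top)
  refine ⟨ξ, ⟨pos_of_marginalE_ne_top (M := M) ?_, hξ.2⟩, h⟩
  rw [h]
  exact ((hB ξ s).trans_lt (ENNReal.add_lt_top.2
    ⟨(marginalE_ne_top ha).lt_top, ENNReal.coe_lt_top⟩)).ne

/-- The Coleman operator. -/
def coleman (hu : M.UtilityAssumption) (hmom : M.MomentAssumption)
    (hcont : M.ContinuityAssumption) (c : M.Candidate) : M.Candidate where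
  toFun s := (exists_root hu hmom hcont c s).choose
  continuous := by
    have hpair : ∀ ξ : ℝ, Continuous fun s : State Z => (ξ, s) := fun ξ => by fun_prop
    have hc := fun ξ : ℝ => (continuous_psiTrunc hu hmom hcont c).comp (hpair ξ)
    exact hu.continuous_of_marginalE_eq (Ψ := M.psiTrunc c.toFun) (psiTrunc_mono hu c)
      (fun ξ _ => hc ξ)
      (fun s => (exists_root hu hmom hcont c s).choose_spec.1.1)
      (fun s => (exists_root hu hmom hcont c s).choose_spec.2)
  monotone z a b hab := by
    obtain ⟨hx, hxr⟩ := (exists_root hu hmom hcont c (a, z)).choose_spec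
    obtain ⟨hy, hyr⟩ := (exists_root hu hmom hcont c (b, z)).choose_spec
    dsimp only
    set x := (exists_root hu hmom hcont c (a, z)).choose
    set y := (exists_root hu hmom hcont c (b, z)).choose
    by_contra hlt
    have hlt := not_le.1 hlt
    exact lt_irrefl _ (calc M.marginalE x < M.marginalE y := hu.strictAnti_marginalE hlt hx.1
      _ = M.psiTrunc c.toFun y (b, z) := hyr
      _ ≤ M.psiTrunc c.toFun x (b, z) := psiTrunc_mono hu c _ hlt.le
      _ ≤ M.psiTrunc c.toFun x (a, z) := psiTrunc_anti hu c x z hab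
      _ = M.marginalE x := hxr.symm)
  pos s := (exists_root hu hmom hcont c s).choose_spec.1.1
  le_assets s := (exists_root hu hmom hcont c s).choose_spec.1.2
  bounded := by
    obtain ⟨B, hB⟩ := psiTrunc_le hu hmom c
    refine ⟨B, fun s => ?_⟩
    obtain ⟨hx, hxr⟩ := (exists_root hu hmom hcont c s).choose_spec
    set x := (exists_root hu hmom hcont c s).choose
    have ha : (0 : ℝ) < s.1 := s.1.2
    have h1 : M.marginal s.1 ≤ M.marginal x :=
      hu.strictAntiOn_marginal.antitoneOn hx.1 ha hx.2
    rw [abs_of_nonneg (sub_nonneg.2 h1), sub_le_iff_le_add']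
    have h2 := hxr.le.trans (hB x s)
    rw [marginalE_of_pos hx.1, marginalE_of_pos ha, ← ENNReal.ofReal_coe_nnreal,
      ← ENNReal.ofReal_add (hu.marginal_pos _ ha).le B.coe_nonneg] at h2
    exact (ENNReal.ofReal_le_ofReal_iff (add_nonneg (hu.marginal_pos _ ha).le B.coe_nonneg)).1 h2

variable (hu : M.UtilityAssumption) (hmom : M.MomentAssumption) (hcont : M.ContinuityAssumption)

lemma marginalE_coleman (c : M.Candidate) (s : State Z) :
    M.marginalE ((coleman hu hmom hcont c).toFun s) =
      M.psi c.toFun ((coleman hu hmom hcont c).toFun s) s.1 s.2 :=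
  (exists_root hu hmom hcont c s).choose_spec.2.trans
    (psiTrunc_eq _ (exists_root hu hmom hcont c s).choose_spec.1.2)

lemma isColeman_coleman : M.IsColeman (coleman hu hmom hcont) := by
  intro c s ξ
  constructor
  · rintro ⟨hξ, h⟩
    exact root_unique hu c hξ.1 ((coleman hu hmom hcont c).pos s) h
      (marginalE_coleman hu hmom hcont c s)
  · rintro rfl
    exact ⟨⟨(coleman hu hmom hcont c).pos s, (coleman hu hmom hcont c).le_assets s⟩,
      marginalE_coleman hu hmom hcont c s⟩

/-- If `Td ≤ Tc` there is nothing to prove. Otherwise `ψ_c` and `ψ_d` are compared at the same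
consumption `x = Tc`, where next period's assets agree, and monotonicity of `ψ_d` moves `x` up to `y
= Td`. Keeping the gap `γ` a function of `z`, rather than its supremum, is what produces `E_z R_1 ⋯
R_n` after `n` steps instead of a power of `sup E_z R̂`. -/
lemma marginalE_coleman_le {c d : M.Candidate} {γ : Z → ℝ≥0∞} (hγ : Measurable γ)
    (h : ∀ s, M.marginalE (c.toFun s) ≤ M.marginalE (d.toFun s) + γ s.2) (s : State Z) :
    M.marginalE ((coleman hu hmom hcont c).toFun s) ≤
      M.marginalE ((coleman hu hmom hcont d).toFun s) + M.β * M.returnOp γ s.2 := by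
  set x := (coleman hu hmom hcont c).toFun s
  set y := (coleman hu hmom hcont d).toFun s with hy
  rcases le_or_gt y x with hyx | hxy
  · exact le_add_right (hu.antitone_marginalE hyx)
  have hmean : M.eulerMean c.toFun (s.1 - x) s.2 ≤
      M.eulerMean d.toFun (s.1 - x) s.2 + M.returnOp γ s.2 := by
    have hm : Measurable fun w : Z × E × H => (M.R (w.1, w.2.1) : ℝ≥0∞) * γ w.1 :=
      measurable_return.mul (hγ.comp measurable_fst)
    rw [eulerMean, eulerMean, returnOp, ← lintegral_add_right _ hm]
    refine lintegral_mono fun w => ?_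
    dsimp only
    rw [← mul_add]
    gcongr
    set a := (M.R (w.1, w.2.1) : ℝ) * (s.1 - x) + M.Y (w.1, w.2.2)
    rcases le_or_gt a 0 with ha | ha
    · simp [extend_of_nonpos _ ha, marginalE_of_nonpos le_rfl]
    · simpa only [extend_of_pos _ ha] using h (⟨a, ha⟩, w.1)
  calc M.marginalE x = M.psi c.toFun x s.1 s.2 := marginalE_coleman hu hmom hcont c s
    _ ≤ M.psi d.toFun x s.1 s.2 + M.β * M.returnOp γ s.2 := by
        rw [psi_eq, psi_eq, ← max_add_add_right, ← mul_add]
        exact max_le_max (by gcongr) le_self_add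
    _ ≤ M.psi d.toFun y s.1 s.2 + M.β * M.returnOp γ s.2 := by
        gcongr
        exact psi_mono hu d s.1 s.2 hxy.le
    _ = _ := by rw [hy, ← marginalE_coleman hu hmom hcont d s]

lemma marginalE_coleman_iterate_le {c d : M.Candidate} {r : ℝ≥0∞}
    (h : ∀ s, M.marginalE (c.toFun s) ≤ M.marginalE (d.toFun s) + r) (k : ℕ) (s : State Z) :
    M.marginalE (((coleman hu hmom hcont)^[k] c).toFun s) ≤
      M.marginalE (((coleman hu hmom hcont)^[k] d).toFun s) +
        r * (M.β ^ k * (M.returnOp^[k] fun _ => 1) s.2) := by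
  induction k generalizing s with
  | zero => simpa using h s
  | succ k ih =>
    have hm := measurable_returnOp_iterate (M := M) (γ := fun _ => 1) measurable_const k
    simp only [Function.iterate_succ_apply']
    simp only [← mul_assoc] at ih
    refine (marginalE_coleman_le hu hmom hcont (hm.const_mul (r * (M.β : ℝ≥0∞) ^ k)) ih s).trans
      (add_le_add le_rfl ?_)
    rw [returnOp_const_mul hm, pow_succ]
    exact (by ring : _ = _).le

end Coleman

end IncomeFluctuation

/-- A sequence in `[0, ∞)` that contracts every `n` steps is summable. -/
lemma tsum_ne_top_of_add_le_mul {w : ℕ → ℝ≥0∞} (hw : ∀ k, w k ≠ ⊤) {θ : ℝ≥0∞} (hθ : θ < 1) {n : ℕ}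
    (h : ∀ k, w (n + k) ≤ θ * w k) : ∑' k, w k ≠ ⊤ := by
  set C := ∑ k ∈ Finset.range n, w k with hC
  have hfin : ∀ N, ∑ k ∈ Finset.range N, w k ≠ ⊤ := fun N =>
    ENNReal.sum_ne_top.2 fun k _ => hw k
  have h1θ : 1 - θ ≠ 0 := (tsub_pos_of_lt hθ).ne'
  have hbound : ∀ N, ∑ k ∈ Finset.range N, w k ≤ C / (1 - θ) := by
    intro N
    set S := ∑ k ∈ Finset.range N, w k with hS
    -- Splitting off the first `n` terms bounds a partial sum in terms of itself; since it is
    -- finite, the inequality can be solved for it.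
    have h1 : S ≤ C + S * θ := by
      calc S ≤ ∑ k ∈ Finset.range (n + N), w k :=
            Finset.sum_le_sum_of_subset (Finset.range_subset_range.2 (Nat.le_add_left N n))
        _ = C + ∑ k ∈ Finset.range N, w (n + k) := Finset.sum_range_add _ _ _
        _ ≤ C + ∑ k ∈ Finset.range N, θ * w k := by gcongr; exact h _
        _ = C + S * θ := by rw [← Finset.mul_sum, mul_comm]
    rw [ENNReal.le_div_iff_mul_le (.inl h1θ) (.inl (ENNReal.sub_ne_top ENNReal.one_ne_top)),
      ENNReal.mul_sub fun _ _ => hfin N, mul_one, tsub_le_iff_right]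
    exact h1
  have hle : ∑' k, w k ≤ C / (1 - θ) := ENNReal.tsum_le_of_sum_range_le hbound
  exact (hle.trans_lt (ENNReal.div_lt_top (hfin n) h1θ)).ne

namespace IncomeFluctuation

variable {Z E H : Type*} [TopologicalSpace Z] [MeasurableSpace Z] [MeasurableSpace E]
  [MeasurableSpace H] {M : IncomeFluctuation Z E H}

/-! ### Expectations along paths -/

instance (z : Z) : IsProbabilityMeasure (M.pathLaw z) := by
  unfold pathLaw
  infer_instance

lemma lintegral_pathLaw_zero {f : Z × E × H → ℝ≥0∞} (hf : Measurable f) (z : Z) :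
    ∫⁻ ω, f (ω 0) ∂(M.pathLaw z) = ∫⁻ e, f (z, e) ∂(M.ν.prod M.μ) := by
  have hf0 : Measurable fun ω : ℕ → Z × E × H => f (ω 0) := hf.comp (measurable_pi_apply 0)
  rw [pathLaw, Kernel.trajMeasure, Measure.lintegral_bind (Kernel.aemeasurable _)
    hf0.aemeasurable]
  have h1 : ∀ x₀ : (i : Finset.Iic 0) → Z × E × H,
      ∫⁻ ω, f (ω 0) ∂(Kernel.traj (X := fun _ => Z × E × H) M.historyKernel 0 x₀) =
        f (x₀ ⟨0, by simp⟩) := by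
    intro x₀
    rw [Kernel.lintegral_traj _ hf0]
    simp [Function.updateFinset]
  simp_rw [h1]
  have hf1 : Measurable fun x₀ : (i : Finset.Iic 0) → Z × E × H => f (x₀ ⟨0, by simp⟩) :=
    hf.comp (measurable_pi_apply _)
  rw [lintegral_map hf1 (MeasurableEquiv.measurable _)]
  change ∫⁻ x, f x ∂((Measure.dirac z).prod (M.ν.prod M.μ)) = _
  rw [lintegral_prod _ hf.aemeasurable, lintegral_dirac' _ hf.lintegral_prod_right']

lemma lintegral_pathLaw_zero_fst {g : Z → ℝ≥0∞} (hg : Measurable g) (z : Z) :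
    ∫⁻ ω, g (ω 0).1 ∂(M.pathLaw z) = g z := by
  rw [lintegral_pathLaw_zero (f := fun w => g w.1) (hg.comp measurable_fst)]
  simp

/-- The Markov property: next period's shocks are drawn from the shock kernel. -/
lemma lintegral_pathLaw_succ (z : Z) (t : ℕ) {F : (ℕ → Z × E × H) → Z × E × H → ℝ≥0∞}
    (hF : Measurable (Function.uncurry F))
    (hadapt : ∀ ω ω', (∀ i ≤ t, ω i = ω' i) → F ω = F ω') :
    ∫⁻ ω, F ω (ω (t + 1)) ∂(M.pathLaw z) =
      ∫⁻ ω, ∫⁻ x, F ω x ∂(M.shockKernel (ω t).1) ∂(M.pathLaw z) := by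
  -- A finite history is continued by freezing its last entry. As `F` looks only at dates up to `t`,
  -- this exhibits it as a function of the history.
  let ext : (Finset.Iic t → Z × E × H) → ℕ → Z × E × H :=
    fun h i => h ⟨min i t, Finset.mem_Iic.2 (min_le_right _ _)⟩
  have hext : Measurable ext := measurable_pi_lambda _ fun i => measurable_pi_apply _
  let f : (Finset.Iic t → Z × E × H) × (Z × E × H) → ℝ≥0∞ := fun p => F (ext p.1) p.2
  have hf : Measurable f := hF.comp ((hext.comp measurable_fst).prodMk measurable_snd)
  have hFf : ∀ ω x, F ω x = f (Preorder.frestrictLe t ω, x) := fun ω x => by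
    have : F ω = F (ext (Preorder.frestrictLe t ω)) := hadapt _ _ fun i hi => by
      simp [ext, hi]
    simp only [f]
    rw [this]
  have hrestr : Measurable
      (Preorder.frestrictLe t : (ℕ → Z × E × H) → (Finset.Iic t → Z × E × H)) := by fun_prop
  have key := Kernel.map_frestrictLe_trajMeasure_compProd_eq_map_trajMeasure
    (X := fun _ => Z × E × H) (μ₀ := (Measure.dirac z).prod (M.ν.prod M.μ))
    (κ := M.historyKernel) (a := t)
  calc ∫⁻ ω, F ω (ω (t + 1)) ∂(M.pathLaw z)
      = ∫⁻ p, f p ∂((M.pathLaw z).map fun ω => (Preorder.frestrictLe t ω, ω (t + 1))) := by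
        rw [lintegral_map hf (hrestr.prodMk (measurable_pi_apply _))]
        simp_rw [hFf]
    _ = ∫⁻ p, f p ∂((M.pathLaw z).map (Preorder.frestrictLe t) ⊗ₘ M.historyKernel t) := by
        rw [pathLaw, key]
    _ = ∫⁻ h, ∫⁻ x, f (h, x) ∂(M.historyKernel t h)
          ∂((M.pathLaw z).map (Preorder.frestrictLe t)) := by
        have : IsProbabilityMeasure ((M.pathLaw z).map (Preorder.frestrictLe (π := fun _ =>
          Z × E × H) t)) := Measure.isProbabilityMeasure_map hrestr.aemeasurable
        rw [Measure.lintegral_compProd hf]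
    _ = ∫⁻ ω, ∫⁻ x, F ω x ∂(M.shockKernel (ω t).1) ∂(M.pathLaw z) := by
        rw [lintegral_map hf.lintegral_kernel_prod_right' hrestr]
        refine lintegral_congr fun ω => ?_
        simp_rw [hFf]
        rw [historyKernel, Kernel.comap_apply]
        rfl

lemma measurable_returnAt (t : ℕ) :
    Measurable fun ω : ℕ → Z × E × H => (M.returnAt ω t : ℝ≥0∞) :=
  measurable_return.comp (measurable_pi_apply t)

lemma measurable_incomeAt (t : ℕ) :
    Measurable fun ω : ℕ → Z × E × H => (M.incomeAt ω t : ℝ≥0∞) :=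
  measurable_income.comp (measurable_pi_apply t)

/-- The Markov property at the last date replaces `R_{n+1} γ(z_{n+1})` by `(L γ)(z_n)`; the
induction therefore runs over all `γ`. -/
lemma lintegral_prod_returnAt (z : Z) (n : ℕ) {γ : Z → ℝ≥0∞} (hγ : Measurable γ) :
    ∫⁻ ω, (∏ t ∈ Finset.Icc 1 n, (M.returnAt ω t : ℝ≥0∞)) * γ (ω n).1 ∂(M.pathLaw z) =
      (M.returnOp^[n] γ) z := by
  induction n generalizing γ with
  | zero => simpa using lintegral_pathLaw_zero_fst hγ z
  | succ n ih =>
    have hprod : Measurable fun ω : ℕ → Z × E × H =>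
        ∏ t ∈ Finset.Icc 1 n, (M.returnAt ω t : ℝ≥0∞) :=
      Finset.measurable_fun_prod _ fun t _ => measurable_returnAt t
    have hm : Measurable fun w : Z × E × H => (M.R (w.1, w.2.1) : ℝ≥0∞) * γ w.1 :=
      measurable_return.mul (hγ.comp measurable_fst)
    have hstep := lintegral_pathLaw_succ (M := M) z n
      (F := fun ω x => (∏ t ∈ Finset.Icc 1 n, (M.returnAt ω t : ℝ≥0∞)) *
        (M.R (x.1, x.2.1) * γ x.1))
      ((hprod.comp measurable_fst).mul (hm.comp measurable_snd))
      (fun ω ω' h => by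
        funext x
        congr 1
        refine Finset.prod_congr rfl fun t ht => ?_
        simp only [returnAt, h t (Finset.mem_Icc.1 ht).2])
    rw [Function.iterate_succ_apply, ← ih (measurable_returnOp hγ)]
    refine Eq.trans (lintegral_congr fun ω => ?_) (hstep.trans (lintegral_congr fun ω => ?_))
    · rw [Finset.prod_Icc_succ_top (by omega), mul_assoc]
      rfl
    · rw [lintegral_const_mul _ hm]
      rfl

lemma theta_eq (n : ℕ) :
    M.theta n = (M.β : ℝ≥0∞) ^ n * ⨆ z, (M.returnOp^[n] fun _ => 1) z := by
  rw [theta]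
  congr 2
  funext z
  rw [← lintegral_prod_returnAt z n measurable_const]
  simp

/-! ### Discounted assets -/

/-- `Lʲ 1` lies below its supremum, a constant that passes through the monotone homogeneous operator
`Lᵏ`. -/
lemma iSup_returnOp_add_le (j k : ℕ) :
    ⨆ z, (M.returnOp^[j + k] fun _ => 1) z ≤
      (⨆ z, (M.returnOp^[j] fun _ => 1) z) * ⨆ z, (M.returnOp^[k] fun _ => 1) z := by
  refine iSup_le fun z => ?_
  have h1 : (M.returnOp^[j] fun _ => 1) ≤
      fun _ : Z => (⨆ z, (M.returnOp^[j] fun _ => 1) z) * 1 := fun y => by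
    rw [mul_one]; exact le_iSup (M.returnOp^[j] fun _ => 1) y
  rw [add_comm, Function.iterate_add_apply]
  refine (returnOp_mono.iterate k h1 z).trans ?_
  rw [returnOp_iterate_const_mul measurable_const]
  exact mul_le_mul' le_rfl (le_iSup (M.returnOp^[k] fun _ => 1) z)

/-- By submultiplicativity the terms shrink by the factor `θ` every `n` steps, and each is finite
because `sup E_z R̂` is. -/
lemma tsum_returnOp_ne_top (hmom : M.MomentAssumption) {n : ℕ} (hθ : M.theta n < 1) :
    ∑' k, (M.β : ℝ≥0∞) ^ k * ⨆ z, (M.returnOp^[k] fun _ => 1) z ≠ ⊤ := by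
  have hfin : ∀ k, ⨆ z, (M.returnOp^[k] fun _ => 1) z ≠ ⊤ := by
    intro k
    induction k with
    | zero => exact ((iSup_le fun _ => le_rfl : (⨆ _ : Z, (1 : ℝ≥0∞)) ≤ 1).trans_lt
        ENNReal.one_lt_top).ne
    | succ k ih =>
      refine ((iSup_returnOp_add_le k 1).trans_lt (ENNReal.mul_lt_top ih.lt_top ?_)).ne
      simpa [returnOp_one] using hmom.mean_return
  refine tsum_ne_top_of_add_le_mul (fun k => ENNReal.mul_ne_top (by simp) (hfin k)) hθ
    (n := n) fun k => ?_
  rw [theta_eq, pow_add, mul_mul_mul_comm]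
  gcongr
  exact iSup_returnOp_add_le n k

/-- `∑ₖ βᵏ E_z R_1 ⋯ R_k`. -/
def totalReturn (M : IncomeFluctuation Z E H) (z : Z) : ℝ≥0∞ :=
  ∑' k, (M.β : ℝ≥0∞) ^ k * (M.returnOp^[k] fun _ => 1) z

lemma totalReturn_le (z : Z) :
    M.totalReturn z ≤ ∑' k, (M.β : ℝ≥0∞) ^ k * ⨆ z, (M.returnOp^[k] fun _ => 1) z :=
  ENNReal.tsum_le_tsum fun k => by gcongr; exact le_iSup (M.returnOp^[k] fun _ => 1) z

lemma measurable_totalReturn : Measurable M.totalReturn :=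
  Measurable.tsum fun k =>
    (measurable_returnOp_iterate measurable_const k).const_mul _

lemma totalReturn_eq (z : Z) : M.totalReturn z = 1 + M.β * M.returnOp M.totalReturn z := by
  have h1 : M.returnOp M.totalReturn z =
      ∑' k, (M.β : ℝ≥0∞) ^ k * (M.returnOp^[k + 1] fun _ => 1) z := by
    have hm : ∀ k, Measurable fun w : Z × E × H => (M.R (w.1, w.2.1) : ℝ≥0∞) *
        ((M.β : ℝ≥0∞) ^ k * (M.returnOp^[k] fun _ => 1) w.1) := fun k =>
      measurable_return.mul
        (((measurable_returnOp_iterate measurable_const k).comp measurable_fst).const_mul _)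
    rw [returnOp]
    simp_rw [totalReturn, ← ENNReal.tsum_mul_left]
    rw [lintegral_tsum fun k => (hm k).aemeasurable]
    refine tsum_congr fun k => ?_
    rw [Function.iterate_succ_apply']
    exact congrFun (returnOp_const_mul (measurable_returnOp_iterate measurable_const k)) z
  rw [h1, totalReturn, tsum_eq_zero_add' ENNReal.summable, ← ENNReal.tsum_mul_left]
  simp only [pow_zero, Function.iterate_zero, id_eq, one_mul, pow_succ']
  simp_rw [mul_assoc]

/-- Assets if nothing is ever consumed. -/
def maxAssets (M : IncomeFluctuation Z E H) (a : ℝ≥0∞) (ω : ℕ → Z × E × H) : ℕ → ℝ≥0∞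
  | 0 => a
  | t + 1 => M.returnAt ω (t + 1) * maxAssets M a ω t + M.incomeAt ω (t + 1)

lemma measurable_maxAssets (a : ℝ≥0∞) (t : ℕ) : Measurable fun ω => M.maxAssets a ω t := by
  induction t with
  | zero => exact measurable_const
  | succ t ih => exact ((measurable_returnAt (t + 1)).mul ih).add (measurable_incomeAt (t + 1))

lemma maxAssets_congr (a : ℝ≥0∞) {t : ℕ} {ω ω' : ℕ → Z × E × H} (h : ∀ i ≤ t, ω i = ω' i) :
    M.maxAssets a ω t = M.maxAssets a ω' t := by
  induction t with
  | zero => rfl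
  | succ t ih =>
    simp only [maxAssets, returnAt, incomeAt, h (t + 1) le_rfl,
      ih fun i hi => h i (hi.trans t.le_succ)]

/-- The weight `V = totalReturn` solves `V = 1 + β L V`, so it acts as a Lyapunov function: passing
from `βᵗ E a_t V(z_t)` to the next date releases exactly `βᵗ E a_t` and adds at most `S` times
discounted income. Summation over dates telescopes. -/
lemma tsum_maxAssets_ne_top (hmom : M.MomentAssumption) {n : ℕ} (hθ : M.theta n < 1)
    (hY : M.IncomeAssumption) {a : ℝ≥0∞} (ha : a ≠ ⊤) (z : Z) :
    ∑' t, (M.β : ℝ≥0∞) ^ t * ∫⁻ ω, M.maxAssets a ω t ∂(M.pathLaw z) ≠ ⊤ := by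
  set S := ∑' k, (M.β : ℝ≥0∞) ^ k * ⨆ z, (M.returnOp^[k] fun _ => 1) z
  have hS : S ≠ ⊤ := tsum_returnOp_ne_top hmom hθ
  set y : ℕ → ℝ≥0∞ := fun t =>
    (M.β : ℝ≥0∞) ^ (t + 1) * ∫⁻ ω, (M.incomeAt ω (t + 1) : ℝ≥0∞) ∂(M.pathLaw z) with hy
  set A : ℕ → ℝ≥0∞ := fun t =>
    (M.β : ℝ≥0∞) ^ t * ∫⁻ ω, M.maxAssets a ω t ∂(M.pathLaw z) with hA
  set B : ℕ → ℝ≥0∞ := fun t =>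
    (M.β : ℝ≥0∞) ^ t * ∫⁻ ω, M.maxAssets a ω t * M.totalReturn (ω t).1 ∂(M.pathLaw z) with hB
  have hVm : ∀ t, Measurable fun ω : ℕ → Z × E × H => M.totalReturn (ω t).1 := fun t =>
    measurable_totalReturn.comp (measurable_fst.comp (measurable_pi_apply t))
  have hRm : Measurable fun w : Z × E × H => (M.R (w.1, w.2.1) : ℝ≥0∞) * M.totalReturn w.1 :=
    measurable_return.mul (measurable_totalReturn.comp measurable_fst)
  have hstep : ∀ t, A t + B (t + 1) ≤ B t + S * y t := by
    intro t
    have h1 : ∫⁻ ω, M.maxAssets a ω t * (M.returnAt ω (t + 1) * M.totalReturn (ω (t + 1)).1)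
        ∂(M.pathLaw z) =
        ∫⁻ ω, M.maxAssets a ω t * M.returnOp M.totalReturn (ω t).1 ∂(M.pathLaw z) := by
      refine (lintegral_pathLaw_succ (M := M) z t
        (F := fun ω x => M.maxAssets a ω t * (M.R (x.1, x.2.1) * M.totalReturn x.1))
        (((measurable_maxAssets a t).comp measurable_fst).mul (hRm.comp measurable_snd))
        (fun ω ω' h => by funext x; rw [maxAssets_congr a h])).trans
        (lintegral_congr fun ω => ?_)
      rw [lintegral_const_mul _ hRm]
      rfl
    have h2 : ∫⁻ ω, M.maxAssets a ω (t + 1) * M.totalReturn (ω (t + 1)).1 ∂(M.pathLaw z) ≤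
        ∫⁻ ω, M.maxAssets a ω t * M.returnOp M.totalReturn (ω t).1 ∂(M.pathLaw z) +
          S * ∫⁻ ω, (M.incomeAt ω (t + 1) : ℝ≥0∞) ∂(M.pathLaw z) := by
      rw [← h1, ← lintegral_const_mul _ (measurable_incomeAt _), ← lintegral_add_right _
        ((measurable_incomeAt (t + 1)).const_mul S)]
      refine lintegral_mono fun ω => ?_
      simp only [maxAssets]
      rw [add_mul, mul_comm S]
      refine add_le_add (le_of_eq (by ring)) ?_
      gcongr
      exact totalReturn_le _
    have h3 : ∫⁻ ω, M.maxAssets a ω t * M.totalReturn (ω t).1 ∂(M.pathLaw z) =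
        ∫⁻ ω, M.maxAssets a ω t ∂(M.pathLaw z) +
        M.β * ∫⁻ ω, M.maxAssets a ω t * M.returnOp M.totalReturn (ω t).1 ∂(M.pathLaw z) := by
      have hm : Measurable fun ω : ℕ → Z × E × H =>
          M.maxAssets a ω t * M.returnOp M.totalReturn (ω t).1 :=
        (measurable_maxAssets a t).mul ((measurable_returnOp measurable_totalReturn).comp
          (measurable_fst.comp (measurable_pi_apply t)))
      rw [← lintegral_const_mul _ hm, ← lintegral_add_left (measurable_maxAssets a t)]
      refine lintegral_congr fun ω => ?_
      rw [totalReturn_eq]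
      ring
    simp only [hA, hB, hy]
    rw [h3]
    calc _ ≤ _ := add_le_add le_rfl (mul_le_mul' le_rfl h2)
      _ = _ := by ring
  have hpartial : ∀ T, ∑ t ∈ Finset.range T, A t + B T ≤ B 0 + S * ∑ t ∈ Finset.range T, y t := by
    intro T
    induction T with
    | zero => simp
    | succ T ih =>
      rw [Finset.sum_range_succ, Finset.sum_range_succ, mul_add, ← add_assoc]
      calc _ = ∑ t ∈ Finset.range T, A t + (A T + B (T + 1)) := by rw [add_assoc]
        _ ≤ ∑ t ∈ Finset.range T, A t + (B T + S * y T) := add_le_add le_rfl (hstep T)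
        _ = (∑ t ∈ Finset.range T, A t + B T) + S * y T := by rw [add_assoc]
        _ ≤ _ := add_le_add ih le_rfl
  have hB0 : B 0 ≤ a * S := by
    simp only [hB, maxAssets, pow_zero, one_mul]
    rw [lintegral_const_mul _ (hVm 0), lintegral_pathLaw_zero_fst measurable_totalReturn]
    gcongr
    exact totalReturn_le z
  have hle : ∑' t, A t ≤ a * S + S * ∑' t, y t :=
    ENNReal.tsum_le_of_sum_range_le fun T => le_self_add.trans ((hpartial T).trans
      (add_le_add hB0 (mul_le_mul' le_rfl (ENNReal.sum_le_tsum _))))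
  exact (hle.trans_lt (ENNReal.add_lt_top.2 ⟨ENNReal.mul_lt_top ha.lt_top hS.lt_top,
    ENNReal.mul_lt_top hS.lt_top (hY z)⟩)).ne

end IncomeFluctuation

/-! ### From additive inequalities in `[0, ∞]` to inequalities between values -/

lemma EReal.coe_ennreal_sub_le_sub {A B C D : ℝ≥0∞} (hA : A ≠ ⊤) (hC : C ≠ ⊤)
    (h : A + D ≤ C + B) : (A : EReal) - B ≤ C - D := by
  rcases eq_or_ne B ⊤ with rfl | hB
  · simp
  have hD : D ≠ ⊤ := ((le_add_self.trans h).trans_lt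
    (ENNReal.add_lt_top.2 ⟨hC.lt_top, hB.lt_top⟩)).ne
  lift A to ℝ≥0 using hA
  lift B to ℝ≥0 using hB
  lift C to ℝ≥0 using hC
  lift D to ℝ≥0 using hD
  simp only [EReal.coe_nnreal_eq_coe_real, ← EReal.coe_sub, EReal.coe_le_coe_iff]
  have h' : (A : ℝ) + D ≤ C + B := by exact_mod_cast h
  linarith

lemma EReal.coe_ennreal_sub_lt_sub {A B C D δ : ℝ≥0∞} (hδ : δ ≠ 0) (hB : B ≠ ⊤) (hC : C ≠ ⊤)
    (h : A + D + δ ≤ C + B) : (A : EReal) - B < C - D := by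
  have hCB : C + B ≠ ⊤ := ENNReal.add_ne_top.2 ⟨hC, hB⟩
  have hA : A ≠ ⊤ := ((le_self_add.trans (le_self_add.trans h)).trans_lt hCB.lt_top).ne
  have hD : D ≠ ⊤ := ((le_add_self.trans (le_self_add.trans h)).trans_lt hCB.lt_top).ne
  have hlt : A + D < C + B := (ENNReal.lt_add_right (ENNReal.add_ne_top.2 ⟨hA, hD⟩) hδ).trans_le h
  lift A to ℝ≥0 using hA
  lift B to ℝ≥0 using hB
  lift C to ℝ≥0 using hC
  lift D to ℝ≥0 using hD
  simp only [EReal.coe_nnreal_eq_coe_real, ← EReal.coe_sub, EReal.coe_lt_coe_iff]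
  have h' : (A : ℝ) + D < C + B := by exact_mod_cast hlt
  linarith

namespace IncomeFluctuation

variable {Z E H : Type*} [TopologicalSpace Z] [MeasurableSpace Z] [MeasurableSpace E]
  [MeasurableSpace H] {M : IncomeFluctuation Z E H}

/-! ### Consumption and savings along asset paths -/

/-- Consumption along the asset path. -/
def consumption (M : IncomeFluctuation Z E H) (c : State Z → ℝ) (a : ℝ) (ω : ℕ → Z × E × H)
    (t : ℕ) : ℝ :=
  extend c (M.assetPath c a ω t) (ω t).1

/-- Savings along the asset path. -/
def savings (M : IncomeFluctuation Z E H) (c : State Z → ℝ) (a : ℝ) (ω : ℕ → Z × E × H)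
    (t : ℕ) : ℝ :=
  M.assetPath c a ω t - M.consumption c a ω t

lemma assetPath_succ (c : State Z → ℝ) (a : ℝ) (ω : ℕ → Z × E × H) (t : ℕ) :
    M.assetPath c a ω (t + 1) =
      M.returnAt ω (t + 1) * M.savings c a ω t + M.incomeAt ω (t + 1) := rfl

lemma assetPath_congr (c : State Z → ℝ) (a : ℝ) {t : ℕ} {ω ω' : ℕ → Z × E × H}
    (h : ∀ i ≤ t, ω i = ω' i) : M.assetPath c a ω t = M.assetPath c a ω' t := by
  induction t with
  | zero => rfl
  | succ t ih =>
    simp only [assetPath, returnAt, incomeAt, h (t + 1) le_rfl, h t t.le_succ,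
      ih fun i hi => h i (hi.trans t.le_succ)]

lemma savings_congr (c : State Z → ℝ) (a : ℝ) {t : ℕ} {ω ω' : ℕ → Z × E × H}
    (h : ∀ i ≤ t, ω i = ω' i) : M.savings c a ω t = M.savings c a ω' t := by
  rw [savings, savings, consumption, consumption, assetPath_congr c a h, h t le_rfl]

namespace IsFeasible

variable {c : State Z → ℝ} (hc : IsFeasible c) {a : ℝ} (ha : 0 ≤ a)
include hc

lemma consumption_nonneg (a : ℝ) (ω : ℕ → Z × E × H) (t : ℕ) : 0 ≤ M.consumption c a ω t :=
  hc.extend_nonneg _ _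

lemma measurable_assetPath (a : ℝ) (t : ℕ) :
    Measurable fun ω : ℕ → Z × E × H => M.assetPath c a ω t := by
  induction t with
  | zero => exact measurable_const
  | succ t ih =>
    have hz : Measurable fun ω : ℕ → Z × E × H => (ω t).1 :=
      measurable_fst.comp (measurable_pi_apply t)
    have hR : Measurable fun ω : ℕ → Z × E × H => (M.returnAt ω (t + 1) : ℝ) :=
      (M.measurable_R.comp (by fun_prop)).coe_nnreal_real
    have hY : Measurable fun ω : ℕ → Z × E × H => (M.incomeAt ω (t + 1) : ℝ) :=
      (M.measurable_Y.comp (by fun_prop)).coe_nnreal_real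
    exact (hR.mul (ih.sub (hc.measurable_extend.comp (ih.prodMk hz)))).add hY

lemma measurable_consumption (a : ℝ) (t : ℕ) :
    Measurable fun ω : ℕ → Z × E × H => M.consumption c a ω t :=
  hc.measurable_extend.comp ((hc.measurable_assetPath a t).prodMk
    (measurable_fst.comp (measurable_pi_apply t)))

lemma measurable_savings (a : ℝ) (t : ℕ) :
    Measurable fun ω : ℕ → Z × E × H => M.savings c a ω t :=
  (hc.measurable_assetPath a t).sub (hc.measurable_consumption a t)

include ha

lemma assetPath_nonneg (ω : ℕ → Z × E × H) (t : ℕ) : 0 ≤ M.assetPath c a ω t := by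
  induction t with
  | zero => exact ha
  | succ t ih =>
    have := hc.extend_le ih (ω t).1
    have h1 : 0 ≤ M.assetPath c a ω t - extend c (M.assetPath c a ω t) (ω t).1 := by linarith
    simp only [assetPath]
    positivity

lemma savings_nonneg (ω : ℕ → Z × E × H) (t : ℕ) : 0 ≤ M.savings c a ω t :=
  sub_nonneg.2 (hc.extend_le (hc.assetPath_nonneg ha ω t) _)

lemma ofReal_consumption_add_savings (ω : ℕ → Z × E × H) (t : ℕ) :
    ENNReal.ofReal (M.consumption c a ω t) + ENNReal.ofReal (M.savings c a ω t) =
      ENNReal.ofReal (M.assetPath c a ω t) := by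
  rw [← ENNReal.ofReal_add (hc.consumption_nonneg a ω t) (hc.savings_nonneg ha ω t), savings,
    add_sub_cancel]

lemma ofReal_assetPath_succ (ω : ℕ → Z × E × H) (t : ℕ) :
    ENNReal.ofReal (M.assetPath c a ω (t + 1)) =
      M.returnAt ω (t + 1) * ENNReal.ofReal (M.savings c a ω t) + M.incomeAt ω (t + 1) := by
  have := hc.savings_nonneg (M := M) ha ω t
  rw [assetPath_succ, ENNReal.ofReal_add (by positivity) (by positivity),
    ENNReal.ofReal_mul (by positivity), ENNReal.ofReal_coe_nnreal, ENNReal.ofReal_coe_nnreal]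

lemma ofReal_assetPath_le (ω : ℕ → Z × E × H) (t : ℕ) :
    ENNReal.ofReal (M.assetPath c a ω t) ≤ M.maxAssets (ENNReal.ofReal a) ω t := by
  induction t with
  | zero => exact le_rfl
  | succ t ih =>
    rw [hc.ofReal_assetPath_succ ha, maxAssets]
    gcongr
    refine le_trans ?_ ih
    rw [← hc.ofReal_consumption_add_savings ha ω t]
    exact le_add_self

lemma tsum_assetPath_ne_top (hmom : M.MomentAssumption) {n : ℕ} (hθ : M.theta n < 1)
    (hY : M.IncomeAssumption) (z : Z) :
    ∑' t, (M.β : ℝ≥0∞) ^ t * ∫⁻ ω, ENNReal.ofReal (M.assetPath c a ω t) ∂(M.pathLaw z) ≠ ⊤ := by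
  refine ne_top_of_le_ne_top
    (tsum_maxAssets_ne_top hmom hθ hY (a := ENNReal.ofReal a) ENNReal.ofReal_ne_top z) ?_
  refine ENNReal.tsum_le_tsum fun t => ?_
  gcongr with ω
  exact hc.ofReal_assetPath_le ha ω t

end IsFeasible

/-! ### Lifetime utility -/

lemma UtilityAssumption.monotone_utility (hu : M.UtilityAssumption) : Monotone M.u := by
  intro x y hxy
  rcases eq_or_ne x 0 with rfl | hx
  · exact hu.zero_le y
  rcases hxy.eq_or_lt with rfl | hlt
  · exact le_rfl
  have hx' : (0 : ℝ) < x := by exact_mod_cast pos_iff_ne_zero.2 hx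
  have hlt' : (x : ℝ) < y := by exact_mod_cast hlt
  have h1 := hu.realUtility_lt (hx'.trans hlt') hx' hlt'.ne'
  have h2 := hu.marginal_pos y (hx'.trans hlt')
  have e1 := hu.utility_eq_coe hx'
  have e2 := hu.utility_eq_coe (hx'.trans hlt')
  rw [Real.toNNReal_coe] at e1 e2
  rw [e1, e2, EReal.coe_le_coe_iff]
  nlinarith

/-- Discounted expected utility, positive part. -/
def utilityPos (M : IncomeFluctuation Z E H) (c : State Z → ℝ) (a : ℝ) (z : Z) : ℝ≥0∞ :=
  ∫⁻ ω, ∑' t, (M.β : ℝ≥0∞) ^ t * (M.periodUtility c a ω t).toENNReal ∂(M.pathLaw z)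

/-- Discounted expected utility, negative part. -/
def utilityNeg (M : IncomeFluctuation Z E H) (c : State Z → ℝ) (a : ℝ) (z : Z) : ℝ≥0∞ :=
  ∫⁻ ω, ∑' t, (M.β : ℝ≥0∞) ^ t * (-M.periodUtility c a ω t).toENNReal ∂(M.pathLaw z)

lemma lifetimeValue_eq (c : State Z → ℝ) (s : State Z) :
    M.lifetimeValue c s = (M.utilityPos c s.1 s.2 : EReal) - (M.utilityNeg c s.1 s.2 : EReal) :=
  rfl

namespace IsFeasible

variable {c : State Z → ℝ} (hc : IsFeasible c)
include hc

lemma measurable_periodUtility (hu : M.UtilityAssumption) (a : ℝ) (t : ℕ) :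
    Measurable fun ω => M.periodUtility c a ω t :=
  hu.monotone_utility.measurable.comp (hc.measurable_consumption a t).real_toNNReal

lemma measurable_utilityPos (hu : M.UtilityAssumption) (a : ℝ) (t : ℕ) :
    Measurable fun ω => (M.periodUtility c a ω t).toENNReal :=
  (hc.measurable_periodUtility hu a t).ereal_toENNReal

lemma measurable_utilityNeg (hu : M.UtilityAssumption) (a : ℝ) (t : ℕ) :
    Measurable fun ω => (-M.periodUtility c a ω t).toENNReal :=
  (hc.measurable_periodUtility hu a t).neg.ereal_toENNReal

lemma utilityPos_eq_tsum (hu : M.UtilityAssumption) (a : ℝ) (z : Z) :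
    M.utilityPos c a z =
      ∑' t, (M.β : ℝ≥0∞) ^ t * ∫⁻ ω, (M.periodUtility c a ω t).toENNReal ∂(M.pathLaw z) := by
  rw [utilityPos, lintegral_tsum fun t =>
    ((hc.measurable_utilityPos hu a t).const_mul _).aemeasurable]
  exact tsum_congr fun t => lintegral_const_mul _ (hc.measurable_utilityPos hu a t)

lemma utilityNeg_eq_tsum (hu : M.UtilityAssumption) (a : ℝ) (z : Z) :
    M.utilityNeg c a z =
      ∑' t, (M.β : ℝ≥0∞) ^ t * ∫⁻ ω, (-M.periodUtility c a ω t).toENNReal ∂(M.pathLaw z) := by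
  rw [utilityNeg, lintegral_tsum fun t =>
    ((hc.measurable_utilityNeg hu a t).const_mul _).aemeasurable]
  exact tsum_congr fun t => lintegral_const_mul _ (hc.measurable_utilityNeg hu a t)

end IsFeasible

lemma tsum_discount_ne_top (M : IncomeFluctuation Z E H) {C : ℝ≥0∞} (hC : C ≠ ⊤) :
    ∑' t, (M.β : ℝ≥0∞) ^ t * C ≠ ⊤ := by
  rw [ENNReal.tsum_mul_right, ENNReal.tsum_geometric]
  refine ENNReal.mul_ne_top (ENNReal.inv_ne_top.2 (tsub_pos_of_lt ?_).ne') hC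
  exact_mod_cast M.β_lt_one

/-- The tangent at `1` bounds the positive part of utility by an affine function of assets, whose
discounted mean is summable. -/
lemma IsFeasible.utilityPos_ne_top {c : State Z → ℝ} (hc : IsFeasible c)
    (hu : M.UtilityAssumption) (hmom : M.MomentAssumption) {n : ℕ} (hθ : M.theta n < 1)
    (hY : M.IncomeAssumption) {a : ℝ} (ha : 0 ≤ a) (z : Z) : M.utilityPos c a z ≠ ⊤ := by
  rw [hc.utilityPos_eq_tsum hu]
  have hu1 : (M.u 1).toENNReal ≠ ⊤ := by simpa using M.u_ne_top 1
  have hm1 : M.marginalE 1 ≠ ⊤ := marginalE_ne_top one_pos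
  have hfin : ∑' t, (M.β : ℝ≥0∞) ^ t * (M.u 1).toENNReal + M.marginalE 1 *
      ∑' t, (M.β : ℝ≥0∞) ^ t * ∫⁻ ω, ENNReal.ofReal (M.assetPath c a ω t) ∂(M.pathLaw z) ≠ ⊤ :=
    ENNReal.add_ne_top.2 ⟨M.tsum_discount_ne_top hu1,
      ENNReal.mul_ne_top hm1 (hc.tsum_assetPath_ne_top ha hmom hθ hY z)⟩
  refine ne_top_of_le_ne_top hfin ?_
  rw [← ENNReal.tsum_mul_left, ← ENNReal.tsum_add]
  refine ENNReal.tsum_le_tsum fun t => ?_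
  rw [mul_left_comm, ← mul_add]
  gcongr
  rw [← lintegral_const_mul _ (hc.measurable_assetPath a t).ennreal_ofReal]
  calc ∫⁻ ω, (M.periodUtility c a ω t).toENNReal ∂(M.pathLaw z)
      ≤ ∫⁻ ω, ((M.u 1).toENNReal +
          M.marginalE 1 * ENNReal.ofReal (M.assetPath c a ω t)) ∂(M.pathLaw z) := by
        refine lintegral_mono fun ω => (hu.utility_pos_le (hc.consumption_nonneg a ω t)).trans ?_
        gcongr
        exact hc.extend_le (hc.assetPath_nonneg ha ω t) _
    _ = _ := by rw [lintegral_add_left measurable_const]; simp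

/-- Expected marginal utility of assets is bounded along every asset path. -/
lemma IsFeasible.lintegral_marginalE_assetPath_le {c : State Z → ℝ} (hc : IsFeasible c)
    (hu : M.UtilityAssumption) {a : ℝ} (ha : 0 ≤ a) (z : Z) (t : ℕ) :
    ∫⁻ ω, M.marginalE (M.assetPath c a ω t) ∂(M.pathLaw z) ≤
      M.marginalE a + ⨆ z, M.meanMarginalIncome z := by
  cases t with
  | zero => exact le_add_right (by simp [assetPath])
  | succ t =>
    refine le_add_left ?_
    calc ∫⁻ ω, M.marginalE (M.assetPath c a ω (t + 1)) ∂(M.pathLaw z)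
        ≤ ∫⁻ ω, M.marginalE (M.incomeAt ω (t + 1)) ∂(M.pathLaw z) := by
          refine lintegral_mono fun ω => hu.antitone_marginalE ?_
          have := hc.savings_nonneg (M := M) ha ω t
          rw [assetPath_succ]
          exact le_add_of_nonneg_left (by positivity)
      _ = ∫⁻ ω, M.meanMarginalIncome (ω t).1 ∂(M.pathLaw z) :=
          lintegral_pathLaw_succ (M := M) z t (F := fun _ x => M.marginalE (M.Y (x.1, x.2.2)))
            ((measurable_marginalIncome hu).comp measurable_snd) fun _ _ _ => rfl
      _ ≤ ∫⁻ _, ⨆ z, M.meanMarginalIncome z ∂(M.pathLaw z) :=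
          lintegral_mono fun ω => le_iSup M.meanMarginalIncome _
      _ = _ := by simp


/-! ### The Euler equation -/

/-- The Euler equation `u'(c) = max {β E_z R̂ (u' ∘ c)(R̂ (a - c) + Ŷ, ẑ), u'(a)}`. -/
def Candidate.IsEuler (c : M.Candidate) : Prop :=
  ∀ s : State Z, M.marginalE (c.toFun s) = M.psi c.toFun (c.toFun s) s.1 s.2

namespace Candidate.IsEuler

variable {c : M.Candidate} (hE : c.IsEuler)
include hE

lemma eulerMean_le (a : ℝ) (z : Z) :
    M.β * M.eulerMean c.toFun (a - extend c.toFun a z) z ≤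
      M.marginalE (extend c.toFun a z) := by
  rcases le_or_gt a 0 with ha | ha
  · rw [extend_of_nonpos _ ha, marginalE_of_nonpos le_rfl]; exact le_top
  · rw [extend_of_pos _ ha, hE (⟨a, ha⟩, z), psi_eq]
    exact le_max_left _ _

/-- Complementary slackness: either savings vanish, or `c < a`, so `u'(c) > u'(a)` and the maximum
in the Euler equation is the expectation. -/
lemma savings_mul_eulerMean (hu : M.UtilityAssumption) {a : ℝ} (ha : 0 ≤ a) (z : Z) :
    ENNReal.ofReal (a - extend c.toFun a z) *
        (M.β * M.eulerMean c.toFun (a - extend c.toFun a z) z) =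
      ENNReal.ofReal (a - extend c.toFun a z) * M.marginalE (extend c.toFun a z) := by
  rcases ha.eq_or_lt with rfl | ha
  · simp [extend_of_nonpos c.toFun le_rfl]
  rcases ((c.extend_le_max a z).trans_eq (max_eq_left ha.le)).eq_or_lt with h | h
  · simp [h]
  · congr 1
    have h1 := hu.strictAnti_marginalE h ha
    have h2 := hE (⟨a, ha⟩, z)
    rw [← extend_of_pos c.toFun ha, psi_eq] at h2
    simp only at h2
    rcases max_choice (M.β * M.eulerMean c.toFun (a - extend c.toFun a z) z) (M.marginalE a)
      with h3 | h3
    · rw [h2, h3]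
    · rw [h2, h3] at h1
      exact absurd h1 (lt_irrefl _)

end Candidate.IsEuler

/-! ### Optimality -/

/-- The value at date `0` of the payoff `f` at date `t`, at the prices `βᵗ u'(c_t)`. -/
def priced (M : IncomeFluctuation Z E H) (c : State Z → ℝ) (a : ℝ) (z : Z) (t : ℕ)
    (f : (ℕ → Z × E × H) → ℝ≥0∞) : ℝ≥0∞ :=
  (M.β : ℝ≥0∞) ^ t * ∫⁻ ω, M.marginalE (M.consumption c a ω t) * f ω ∂(M.pathLaw z)

section Optimality

variable [OpensMeasurableSpace (State Z)] (hu : M.UtilityAssumption) (c : M.Candidate)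

include hu

lemma measurable_price (a : ℝ) (t : ℕ) :
    Measurable fun ω : ℕ → Z × E × H => M.marginalE (M.consumption c.toFun a ω t) :=
  hu.measurable_marginalE.comp (c.isFeasible.measurable_consumption a t)

lemma priced_add (a : ℝ) (z : Z) (t : ℕ) {f g : (ℕ → Z × E × H) → ℝ≥0∞} (hf : Measurable f) :
    M.priced c.toFun a z t (fun ω => f ω + g ω) =
      M.priced c.toFun a z t f + M.priced c.toFun a z t g := by
  have hm : Measurable fun ω => M.marginalE (M.consumption c.toFun a ω t) * f ω :=
    (measurable_price hu c a t).mul hf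
  simp_rw [priced, mul_add]
  rw [lintegral_add_left hm, mul_add]

variable {d : State Z → ℝ} (hd : IsFeasible d) {a : ℝ} (ha : 0 ≤ a) (z : Z)

include hd ha

lemma priced_assetPath (t : ℕ) :
    M.priced c.toFun a z t (fun ω => ENNReal.ofReal (M.assetPath d a ω t)) =
      M.priced c.toFun a z t (fun ω => ENNReal.ofReal (M.consumption d a ω t)) +
        M.priced c.toFun a z t (fun ω => ENNReal.ofReal (M.savings d a ω t)) := by
  rw [← priced_add hu c a z t (hd.measurable_consumption a t).ennreal_ofReal]
  simp_rw [hd.ofReal_consumption_add_savings ha]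

/-- Conditioning on date `t` prices the return on the savings of `d` by the marginal utility of `c`
along its own path, which is why both savings processes occur. -/
lemma priced_assetPath_succ (t : ℕ) :
    M.priced c.toFun a z (t + 1) (fun ω => ENNReal.ofReal (M.assetPath d a ω (t + 1))) =
      (M.β : ℝ≥0∞) ^ t * ∫⁻ ω, ENNReal.ofReal (M.savings d a ω t) *
        (M.β * M.eulerMean c.toFun (M.savings c.toFun a ω t) (ω t).1) ∂(M.pathLaw z) +
      M.priced c.toFun a z (t + 1) (fun ω => M.incomeAt ω (t + 1)) := by
  simp_rw [hd.ofReal_assetPath_succ ha]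
  rw [priced_add hu c a z (t + 1) (f := fun ω => M.returnAt ω (t + 1) *
    ENNReal.ofReal (M.savings d a ω t))
    ((measurable_returnAt _).mul (hd.measurable_savings a t).ennreal_ofReal)]
  congr 1
  have hm := measurable_eulerIntegrand hu c
  have hsc := c.isFeasible.measurable_savings (M := M) a t
  have hsd := (hd.measurable_savings (M := M) a t).ennreal_ofReal
  have hFm : Measurable fun p : (ℕ → Z × E × H) × (Z × E × H) =>
      (M.R (p.2.1, p.2.2.1) : ℝ≥0∞) * M.marginalE (extend c.toFun
        (M.R (p.2.1, p.2.2.1) * M.savings c.toFun a p.1 t + M.Y (p.2.1, p.2.2.2)) p.2.1) :=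
    hm.comp ((hsc.comp measurable_fst).prodMk measurable_snd)
  have hstep := lintegral_pathLaw_succ (M := M) z t
    (F := fun ω x => ENNReal.ofReal (M.savings d a ω t) * ((M.R (x.1, x.2.1) : ℝ≥0∞) *
      M.marginalE (extend c.toFun
        (M.R (x.1, x.2.1) * M.savings c.toFun a ω t + M.Y (x.1, x.2.2)) x.1)))
    ((hsd.comp measurable_fst).mul hFm)
    (fun ω ω' h => by funext x; rw [savings_congr d a h, savings_congr c.toFun a h])
  have hin : ∀ ω : ℕ → Z × E × H, ∫⁻ x, ENNReal.ofReal (M.savings d a ω t) *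
      ((M.R (x.1, x.2.1) : ℝ≥0∞) * M.marginalE (extend c.toFun
        (M.R (x.1, x.2.1) * M.savings c.toFun a ω t + M.Y (x.1, x.2.2)) x.1))
        ∂(M.shockKernel (ω t).1) = ENNReal.ofReal (M.savings d a ω t) *
          M.eulerMean c.toFun (M.savings c.toFun a ω t) (ω t).1 := fun ω =>
    lintegral_const_mul _ (hFm.comp (measurable_const.prodMk measurable_id))
  simp_rw [hin] at hstep
  have hbeta : ∫⁻ ω, ENNReal.ofReal (M.savings d a ω t) *
      (M.β * M.eulerMean c.toFun (M.savings c.toFun a ω t) (ω t).1) ∂(M.pathLaw z) =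
      M.β * ∫⁻ ω, ENNReal.ofReal (M.savings d a ω t) *
        M.eulerMean c.toFun (M.savings c.toFun a ω t) (ω t).1 ∂(M.pathLaw z) := by
    rw [← lintegral_const_mul' _ _ ENNReal.coe_ne_top]
    exact lintegral_congr fun ω => by ring
  rw [hbeta, ← hstep, priced, pow_succ, mul_assoc]
  congr 2
  refine lintegral_congr fun ω => ?_
  change _ = _ * (_ * M.marginalE (M.consumption c.toFun a ω (t + 1)))
  simp only [returnAt]
  ring

variable {c} (hE : c.IsEuler)
include hE

/-- Both plans start from the same assets and receive the same priced income. When savings are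
carried to the next date, their priced value cannot increase for `d`, by the Euler inequality, and
is preserved for `c`, by complementary slackness. -/
lemma sum_priced_consumption_le (T : ℕ) :
    ∑ t ∈ Finset.range (T + 1),
        M.priced c.toFun a z t (fun ω => ENNReal.ofReal (M.consumption d a ω t)) +
      M.priced c.toFun a z T (fun ω => ENNReal.ofReal (M.savings d a ω T)) ≤
    ∑ t ∈ Finset.range (T + 1),
        M.priced c.toFun a z t (fun ω => ENNReal.ofReal (M.consumption c.toFun a ω t)) +
      M.priced c.toFun a z T (fun ω => ENNReal.ofReal (M.savings c.toFun a ω T)) := by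
  have hc := c.isFeasible
  induction T with
  | zero =>
    simp only [zero_add, Finset.sum_range_one]
    rw [← priced_assetPath hu c hd ha, ← priced_assetPath hu c hc ha]
    rfl
  | succ T ih =>
    rw [Finset.sum_range_succ, add_assoc, ← priced_assetPath hu c hd ha,
      Finset.sum_range_succ _ (T + 1), add_assoc _ _ (M.priced _ _ _ _ _),
      ← priced_assetPath hu c hc ha, priced_assetPath_succ hu c hd ha,
      priced_assetPath_succ hu c hc ha, ← add_assoc, ← add_assoc]
    refine add_le_add ?_ le_rfl
    refine le_trans ?_ (ih.trans_eq ?_)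
    · refine add_le_add le_rfl ?_
      rw [priced]
      refine mul_le_mul' le_rfl (lintegral_mono fun ω => ?_)
      rw [mul_comm]
      exact mul_le_mul' (hE.eulerMean_le _ _) le_rfl
    · congr 1
      rw [priced]
      congr 1
      refine lintegral_congr fun ω => ?_
      rw [mul_comm]
      exact (hE.savings_mul_eulerMean hu (hc.assetPath_nonneg ha ω T) (ω T).1).symm

end Optimality


/-! ### Transversality and comparison of lifetime values -/

section Value

variable [OpensMeasurableSpace (State Z)] (hu : M.UtilityAssumption) (hmom : M.MomentAssumption)

include hu hmom

lemma exists_lintegral_price_le (c : M.Candidate) {a : ℝ} (ha : 0 < a) (z : Z) :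
    ∃ C : ℝ≥0, ∀ t, ∫⁻ ω, M.marginalE (M.assetPath c.toFun a ω t) ∂(M.pathLaw z) ≤ C ∧
      ∫⁻ ω, M.marginalE (M.consumption c.toFun a ω t) ∂(M.pathLaw z) ≤ C := by
  obtain ⟨K, hK⟩ := c.exists_marginalE_extend_le
  have hfin : M.marginalE a + ⨆ z, M.meanMarginalIncome z ≠ ⊤ :=
    ENNReal.add_ne_top.2 ⟨marginalE_ne_top ha, hmom.mean_marginal.ne⟩
  lift M.marginalE a + ⨆ z, M.meanMarginalIncome z to ℝ≥0 using hfin with C hC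
  refine ⟨C + K, fun t => ?_⟩
  have h1 : ∫⁻ ω, M.marginalE (M.assetPath c.toFun a ω t) ∂(M.pathLaw z) ≤ C := by
    rw [hC]
    exact c.isFeasible.lintegral_marginalE_assetPath_le hu ha.le z t
  push_cast
  refine ⟨le_add_right h1, ?_⟩
  calc ∫⁻ ω, M.marginalE (M.consumption c.toFun a ω t) ∂(M.pathLaw z)
      ≤ ∫⁻ ω, (M.marginalE (M.assetPath c.toFun a ω t) + K) ∂(M.pathLaw z) :=
        lintegral_mono fun ω => hK _ _
    _ = ∫⁻ ω, M.marginalE (M.assetPath c.toFun a ω t) ∂(M.pathLaw z) + K := by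
        rw [lintegral_add_right _ measurable_const]; simp
    _ ≤ C + K := by gcongr

lemma utilityNeg_ne_top (c : M.Candidate) {a : ℝ} (ha : 0 < a) (z : Z) :
    M.utilityNeg c.toFun a z ≠ ⊤ := by
  obtain ⟨C, hC⟩ := exists_lintegral_price_le hu hmom c ha z
  rw [c.isFeasible.utilityNeg_eq_tsum hu]
  have h1 : (-M.u 1).toENNReal ≠ ⊤ := by simpa using hu.finite 1 one_pos
  refine ne_top_of_le_ne_top (M.tsum_discount_ne_top
    (C := (-M.u 1).toENNReal + C) (ENNReal.add_ne_top.2 ⟨h1, ENNReal.coe_ne_top⟩)) ?_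
  refine ENNReal.tsum_le_tsum fun t => ?_
  gcongr
  calc ∫⁻ ω, (-M.periodUtility c.toFun a ω t).toENNReal ∂(M.pathLaw z)
      ≤ ∫⁻ ω, ((-M.u 1).toENNReal + M.marginalE (M.consumption c.toFun a ω t)) ∂(M.pathLaw z) :=
        lintegral_mono fun ω => hu.utility_neg_le _
    _ = (-M.u 1).toENNReal + ∫⁻ ω, M.marginalE (M.consumption c.toFun a ω t) ∂(M.pathLaw z) := by
        rw [lintegral_add_left measurable_const]; simp
    _ ≤ _ := by gcongr; exact (hC t).2

variable {n : ℕ} (hθ : M.theta n < 1) (hY : M.IncomeAssumption)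
include hθ hY

/-- The integrand is at most `(u'(a_t) + K) a_t ≤ u'(a_t) + (u'(1) + K) a_t`, with `E u'(a_t)`
bounded in `t` and discounted assets summable. This supplies both transversality and the finiteness
needed for cancellation. -/
lemma tsum_priced_assetPath_ne_top (c : M.Candidate) {a : ℝ} (ha : 0 < a) (z : Z) :
    ∑' t, M.priced c.toFun a z t (fun ω => ENNReal.ofReal (M.assetPath c.toFun a ω t)) ≠ ⊤ := by
  obtain ⟨K, hK⟩ := c.exists_marginalE_extend_le
  obtain ⟨C, hC⟩ := exists_lintegral_price_le hu hmom c ha z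
  have hc := c.isFeasible
  have hfin : ∑' t, (M.β : ℝ≥0∞) ^ t * C + (M.marginalE 1 + K) *
      ∑' t, (M.β : ℝ≥0∞) ^ t *
        ∫⁻ ω, ENNReal.ofReal (M.assetPath c.toFun a ω t) ∂(M.pathLaw z) ≠ ⊤ :=
    ENNReal.add_ne_top.2 ⟨M.tsum_discount_ne_top ENNReal.coe_ne_top,
      ENNReal.mul_ne_top (ENNReal.add_ne_top.2 ⟨marginalE_ne_top one_pos, ENNReal.coe_ne_top⟩)
        (hc.tsum_assetPath_ne_top ha.le hmom hθ hY z)⟩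
  refine ne_top_of_le_ne_top hfin ?_
  rw [← ENNReal.tsum_mul_left, ← ENNReal.tsum_add]
  refine ENNReal.tsum_le_tsum fun t => ?_
  rw [mul_left_comm, ← mul_add, priced]
  gcongr
  have hm := (hc.measurable_assetPath (M := M) a t).ennreal_ofReal
  rw [← lintegral_const_mul _ hm]
  calc ∫⁻ ω, M.marginalE (M.consumption c.toFun a ω t) *
        ENNReal.ofReal (M.assetPath c.toFun a ω t) ∂(M.pathLaw z)
      ≤ ∫⁻ ω, (M.marginalE (M.assetPath c.toFun a ω t) +
          (M.marginalE 1 + K) * ENNReal.ofReal (M.assetPath c.toFun a ω t)) ∂(M.pathLaw z) := by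
        refine lintegral_mono fun ω => ?_
        have h0 := hc.assetPath_nonneg (M := M) ha.le ω t
        have h1 := hu.marginalE_mul_le (M.assetPath c.toFun a ω t).toNNReal
        rw [Real.coe_toNNReal _ h0] at h1
        calc _ ≤ (M.marginalE (M.assetPath c.toFun a ω t) + K) *
              ENNReal.ofReal (M.assetPath c.toFun a ω t) := mul_le_mul' (hK _ _) le_rfl
          _ ≤ _ := by
              rw [add_mul, add_mul, ← add_assoc]
              exact add_le_add h1 le_rfl
    _ = ∫⁻ ω, M.marginalE (M.assetPath c.toFun a ω t) ∂(M.pathLaw z) +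
          ∫⁻ ω, (M.marginalE 1 + K) * ENNReal.ofReal (M.assetPath c.toFun a ω t)
            ∂(M.pathLaw z) := lintegral_add_right _ (hm.const_mul _)
    _ ≤ _ := add_le_add (hC t).1 le_rfl

/-- Under the prices `βᵗ u'(c_t)`, no feasible consumption plan is worth more than that of a
policy `c` that satisfies the Euler equation. -/
lemma tsum_priced_consumption_le {c : M.Candidate} (hE : c.IsEuler) {d : State Z → ℝ}
    (hd : IsFeasible d) {a : ℝ} (ha : 0 < a) (z : Z) :
    ∑' t, M.priced c.toFun a z t (fun ω => ENNReal.ofReal (M.consumption d a ω t)) ≤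
      ∑' t, M.priced c.toFun a z t (fun ω => ENNReal.ofReal (M.consumption c.toFun a ω t)) := by
  have hc := c.isFeasible
  -- Transversality is needed only for `c`; the priced savings of `d` stand on the smaller side and
  -- are dropped.
  have hsav : Tendsto (fun T => M.priced c.toFun a z T
      (fun ω => ENNReal.ofReal (M.savings c.toFun a ω T))) atTop (𝓝 0) := by
    refine tendsto_of_tendsto_of_tendsto_of_le_of_le tendsto_const_nhds
      (ENNReal.tendsto_atTop_zero_of_tsum_ne_top
        (tsum_priced_assetPath_ne_top hu hmom hθ hY c ha z)) (fun _ => zero_le) fun T => ?_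
    dsimp only
    rw [priced_assetPath hu c hc ha.le]
    exact le_add_self
  have hlim := ((ENNReal.tendsto_nat_tsum fun t => M.priced c.toFun a z t
    (fun ω => ENNReal.ofReal (M.consumption c.toFun a ω t))).comp (tendsto_add_atTop_nat 1)).add
    hsav
  have hlim' := (ENNReal.tendsto_nat_tsum fun t => M.priced c.toFun a z t
    (fun ω => ENNReal.ofReal (M.consumption d a ω t))).comp (tendsto_add_atTop_nat 1)
  rw [add_zero] at hlim
  exact le_of_tendsto_of_tendsto' hlim' hlim fun T =>
    le_self_add.trans (sum_priced_consumption_le hu hd ha.le z hE T)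

/-- Comparison of the utility of a feasible policy `d` with that of a policy `c` satisfying the
Euler equation; `δ` is a gap in the tangent inequality at the initial state. -/
lemma utility_add_le {c : M.Candidate} (hE : c.IsEuler) {d : State Z → ℝ} (hd : IsFeasible d)
    {a : ℝ} (ha : 0 < a) (z : Z) {δ : ℝ≥0∞}
    (hδ : (M.u (extend d a z).toNNReal).toENNReal +
        (-M.u (extend c.toFun a z).toNNReal).toENNReal +
        M.marginalE (extend c.toFun a z) * ENNReal.ofReal (extend c.toFun a z) + δ ≤
      (M.u (extend c.toFun a z).toNNReal).toENNReal +
        (-M.u (extend d a z).toNNReal).toENNReal +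
        M.marginalE (extend c.toFun a z) * ENNReal.ofReal (extend d a z)) :
    M.utilityPos d a z + M.utilityNeg c.toFun a z + δ ≤
      M.utilityPos c.toFun a z + M.utilityNeg d a z := by
  have hc := c.isFeasible
  set Xc := ∑' t, M.priced c.toFun a z t
    (fun ω => ENNReal.ofReal (M.consumption c.toFun a ω t))
  set Xd := ∑' t, M.priced c.toFun a z t
    (fun ω => ENNReal.ofReal (M.consumption d a ω t))
  have hX : Xd ≤ Xc := tsum_priced_consumption_le hu hmom hθ hY hE hd ha z
  have hXc_top : Xc ≠ ⊤ := by
    refine ne_top_of_le_ne_top (tsum_priced_assetPath_ne_top hu hmom hθ hY c ha z) ?_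
    refine ENNReal.tsum_le_tsum fun t => ?_
    rw [priced_assetPath hu c hc ha.le]
    exact le_self_add
  have hjoin : ∀ e f : State Z → ℝ, IsFeasible e → IsFeasible f →
      M.utilityPos e a z + M.utilityNeg f a z + ∑' t, M.priced c.toFun a z t
        (fun ω => ENNReal.ofReal (M.consumption f a ω t)) =
      ∑' t, (M.β : ℝ≥0∞) ^ t * ∫⁻ ω, ((M.periodUtility e a ω t).toENNReal +
        (-M.periodUtility f a ω t).toENNReal + M.marginalE (M.consumption c.toFun a ω t) *
          ENNReal.ofReal (M.consumption f a ω t)) ∂(M.pathLaw z) := by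
    intro e f he hf
    rw [he.utilityPos_eq_tsum hu, hf.utilityNeg_eq_tsum hu, ← ENNReal.tsum_add,
      ← ENNReal.tsum_add]
    refine tsum_congr fun t => ?_
    have hm : Measurable fun ω => (M.periodUtility e a ω t).toENNReal +
        (-M.periodUtility f a ω t).toENNReal :=
      (he.measurable_utilityPos hu a t).add (hf.measurable_utilityNeg hu a t)
    rw [lintegral_add_left hm, lintegral_add_left (he.measurable_utilityPos hu a t), priced,
      mul_add, mul_add]
  have hzero : ∀ e f : State Z → ℝ, IsFeasible e → IsFeasible f →
      ∫⁻ ω, ((M.periodUtility e a ω 0).toENNReal +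
        (-M.periodUtility f a ω 0).toENNReal + M.marginalE (M.consumption c.toFun a ω 0) *
          ENNReal.ofReal (M.consumption f a ω 0)) ∂(M.pathLaw z) =
      (M.u (extend e a z).toNNReal).toENNReal + (-M.u (extend f a z).toNNReal).toENNReal +
        M.marginalE (extend c.toFun a z) * ENNReal.ofReal (extend f a z) := by
    intro e f he hf
    have hx : ∀ {e : State Z → ℝ}, IsFeasible e → Measurable fun z => extend e a z := fun he =>
      he.measurable_extend.comp (measurable_const.prodMk measurable_id)
    have hv : ∀ {e : State Z → ℝ}, IsFeasible e →
        Measurable fun z => M.u (extend e a z).toNNReal := fun he =>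
      hu.monotone_utility.measurable.comp (hx he).real_toNNReal
    exact lintegral_pathLaw_zero_fst (M := M)
      (g := fun z => (M.u (extend e a z).toNNReal).toENNReal +
        (-M.u (extend f a z).toNNReal).toENNReal +
          M.marginalE (extend c.toFun a z) * ENNReal.ofReal (extend f a z))
      (((hv he).ereal_toENNReal.add (hv hf).neg.ereal_toENNReal).add
        ((hu.measurable_marginalE.comp (hx hc)).mul (hx hf).ennreal_ofReal)) z
  -- The tangent inequality is summed over all dates, with date `0` separated because it alone
  -- carries the gap `δ`.
  have hsum : M.utilityPos d a z + M.utilityNeg c.toFun a z + Xc + δ ≤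
      M.utilityPos c.toFun a z + M.utilityNeg d a z + Xd := by
    rw [hjoin d c.toFun hd hc, hjoin c.toFun d hc hd, tsum_eq_zero_add' ENNReal.summable,
      tsum_eq_zero_add' (f := fun t => (M.β : ℝ≥0∞) ^ t * ∫⁻ ω,
        ((M.periodUtility c.toFun a ω t).toENNReal + (-M.periodUtility d a ω t).toENNReal +
          M.marginalE (M.consumption c.toFun a ω t) *
            ENNReal.ofReal (M.consumption d a ω t)) ∂(M.pathLaw z)) ENNReal.summable,
      hzero d c.toFun hd hc, hzero c.toFun d hc hd, add_right_comm, pow_zero, one_mul, one_mul]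
    refine add_le_add hδ (ENNReal.tsum_le_tsum fun t => ?_)
    refine mul_le_mul' le_rfl (lintegral_mono fun ω => ?_)
    exact hu.tangent_le (hc.consumption_nonneg a ω _) (hd.consumption_nonneg a ω _)
  rw [add_right_comm] at hsum
  -- Since `Xd ≤ Xc`, the term `Xd` may be enlarged to `Xc`, which is finite and cancels.
  exact (ENNReal.add_le_add_iff_right hXc_top).1 (hsum.trans (add_le_add le_rfl hX))

theorem Candidate.IsEuler.isOptimal {c : M.Candidate} (hE : c.IsEuler) : M.IsOptimal c.toFun := by
  refine ⟨c.isFeasible, fun d hd s => ?_⟩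
  have ha : (0 : ℝ) < s.1 := s.1.2
  rw [lifetimeValue_eq, lifetimeValue_eq]
  have h := utility_add_le hu hmom hθ hY hE hd ha s.2 (δ := 0) (by
    rw [add_zero]
    exact hu.tangent_le (c.extend_nonneg _ _) (hd.extend_nonneg _ _))
  rw [add_zero] at h
  exact EReal.coe_ennreal_sub_le_sub (hd.utilityPos_ne_top hu hmom hθ hY ha.le s.2)
    (c.isFeasible.utilityPos_ne_top hu hmom hθ hY ha.le s.2) h

/-- If the policies differ at `s`, then starting from `s` they differ at date `0`, where the state
is deterministic, so the strict tangent gap enters lifetime utility in full. Membership of `d` in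
`𝒞` makes its negative part finite; otherwise the gap could be absorbed by `∞`. -/
theorem Candidate.IsEuler.eq_of_isOptimal {c d : M.Candidate} (hE : c.IsEuler)
    (hd : M.IsOptimal d.toFun) : d = c := by
  ext s
  by_contra hne
  have ha : (0 : ℝ) < s.1 := s.1.2
  obtain ⟨δ, hδ, hle⟩ := hu.tangent_add_le (c.pos s) (d.pos s) (Ne.symm hne)
  have h := utility_add_le hu hmom hθ hY hE d.isFeasible ha s.2 (δ := δ) (by
    simpa only [extend_of_pos _ ha] using hle)
  have hlt := EReal.coe_ennreal_sub_lt_sub hδ (utilityNeg_ne_top hu hmom d ha s.2)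
    (c.isFeasible.utilityPos_ne_top hu hmom hθ hY ha.le s.2) h
  rw [← lifetimeValue_eq, ← lifetimeValue_eq] at hlt
  exact hlt.not_ge (hd.2 _ c.isFeasible s)

end Value

/-! ### Contraction -/

lemma rho_comm (c d : M.Candidate) : rho c d = rho d c := by
  simp_rw [rho, abs_sub_comm]

section Contraction

variable [TopologicalSpace.PseudoMetrizableSpace Z] [SecondCountableTopology Z] [BorelSpace Z]
  (hu : M.UtilityAssumption) (hmom : M.MomentAssumption) (hcont : M.ContinuityAssumption)

lemma rho_coleman_iterate_le (n : ℕ) (c d : M.Candidate) :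
    rho ((coleman hu hmom hcont)^[n] c) ((coleman hu hmom hcont)^[n] d) ≤
      M.theta n * rho c d := by
  have key : ∀ c d : M.Candidate, ∀ s,
      M.marginalE (((coleman hu hmom hcont)^[n] c).toFun s) ≤
        M.marginalE (((coleman hu hmom hcont)^[n] d).toFun s) + M.theta n * rho c d := by
    intro c d s
    refine (marginalE_coleman_iterate_le hu hmom hcont
      (fun s => ((Candidate.rho_le_iff hu).1 le_rfl s).1) n s).trans (add_le_add le_rfl ?_)
    rw [theta_eq, mul_comm (rho c d)]
    gcongr
    exact le_iSup (M.returnOp^[n] fun _ => 1) s.2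
  exact (Candidate.rho_le_iff hu).2 fun s => ⟨key c d s, rho_comm c d ▸ key d c s⟩

lemma isEuler_of_coleman_eq {c : M.Candidate} (h : coleman hu hmom hcont c = c) : c.IsEuler := by
  intro s
  have := marginalE_coleman hu hmom hcont c s
  rwa [h] at this

theorem exists_fixedPoint {n : ℕ} (hθ : M.theta n < 1) :
    ∃ c, coleman hu hmom hcont c = c ∧ ∀ d, coleman hu hmom hcont d = d → d = c := by
  obtain ⟨D, hD, hcomplete⟩ := Candidate.exists_completeSpace hu
  have : Nonempty M.Candidate := ⟨Candidate.consumeAll M⟩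
  have hK : M.theta n ≠ ⊤ := (hθ.trans ENNReal.one_lt_top).ne
  have hcontr : ContractingWith (M.theta n).toNNReal (coleman hu hmom hcont)^[n] := by
    refine ⟨?_, fun c d => ?_⟩
    · rw [← ENNReal.coe_lt_coe, ENNReal.coe_toNNReal hK]
      exact_mod_cast hθ
    · rw [hD, hD, ENNReal.coe_toNNReal hK]
      exact rho_coleman_iterate_le hu hmom hcont n c d
  -- `T` commutes with `Tⁿ` and so maps the unique fixed point of `Tⁿ` to itself; conversely, every
  -- fixed point of `T` is one of `Tⁿ`.
  refine ⟨hcontr.fixedPoint _, hcontr.isFixedPt_fixedPoint_iterate, fun d hd => ?_⟩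
  exact hcontr.fixedPoint_unique (Function.IsFixedPt.iterate hd n)

lemma rho_coleman_iterate_mul_le (n : ℕ) {cstar : M.Candidate}
    (hfix : coleman hu hmom hcont cstar = cstar) (c : M.Candidate) (k : ℕ) :
    rho ((coleman hu hmom hcont)^[n * k] c) cstar ≤ M.theta n ^ k * rho c cstar := by
  induction k with
  | zero => simp
  | succ k ih =>
    have h := rho_coleman_iterate_le hu hmom hcont n ((coleman hu hmom hcont)^[n * k] c) cstar
    rw [← Function.iterate_add_apply, (Function.IsFixedPt.iterate hfix n : _ = _),
      show n + n * k = n * (k + 1) by ring] at h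
    refine h.trans ?_
    rw [pow_succ', mul_assoc]
    exact mul_le_mul' le_rfl ih

end Contraction

end IncomeFluctuation

end

theorem theoremt {m : ℕ} (Z : Set (EuclideanSpace ℝ (Fin m))) (hZ : MeasurableSet Z)
    {E H : Type*} [MeasurableSpace E] [MeasurableSpace H]
    (M : IncomeFluctuation Z E H)
    (hu : M.UtilityAssumption)
    (n : ℕ) (hn : 1 ≤ n) (hθ : M.theta n < 1)
    (hY : M.IncomeAssumption)
    (hmom : M.MomentAssumption)
    (hcont : M.ContinuityAssumption) :
    -- `(𝒞, ρ)` is a complete metric space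
    (∃ D : MetricSpace M.Candidate,
      (∀ c d : M.Candidate, edist c d = IncomeFluctuation.rho c d) ∧
      @CompleteSpace M.Candidate D.toUniformSpace) ∧
    -- the Coleman operator is a well-defined self-map of `𝒞`, and its `n`-th iterate contracts
    ∃ T : M.Candidate → M.Candidate, M.IsColeman T ∧
      (∀ c d : M.Candidate,
        IncomeFluctuation.rho (T^[n] c) (T^[n] d) ≤ M.theta n * IncomeFluctuation.rho c d) ∧
      ∃ cstar : M.Candidate,
        (T cstar = cstar ∧ ∀ d : M.Candidate, T d = d → d = cstar) ∧
        (M.IsOptimal cstar.toFun ∧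
          ∀ d : M.Candidate, M.IsOptimal d.toFun → d = cstar) ∧
        ∀ (c : M.Candidate) (k : ℕ),
          IncomeFluctuation.rho (T^[n * k] c) cstar ≤
            M.theta n ^ k * IncomeFluctuation.rho c cstar := by
  refine ⟨IncomeFluctuation.Candidate.exists_completeSpace hu,
    IncomeFluctuation.coleman hu hmom hcont,
    IncomeFluctuation.isColeman_coleman hu hmom hcont,
    IncomeFluctuation.rho_coleman_iterate_le hu hmom hcont n, ?_⟩
  obtain ⟨c, hfix, huniq⟩ := IncomeFluctuation.exists_fixedPoint hu hmom hcont hθ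
  have hE := IncomeFluctuation.isEuler_of_coleman_eq hu hmom hcont hfix
  exact ⟨c, ⟨hfix, huniq⟩,
    ⟨hE.isOptimal hu hmom hθ hY, fun d hd => hE.eq_of_isOptimal hu hmom hθ hY hd⟩,
    IncomeFluctuation.rho_coleman_iterate_mul_le hu hmom hcont n hfix⟩
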